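/- Let $T\in\{A,B,D\}$ be a type, and put $u=1$ for type $A$ and $u=\tfrac12$ for types $B$ and $D$. Let $d(n)$, $n\in\mathbb N$, be non-negative integers, and for each $n$ let $\xi_1,\dots,\xi_n$ (depending on $n$) be random vectors in $\mathbb R^{d}$, $d=d(n)$, on some probability space, with partial sums $S_k=\xi_1+\dots+\xi_k$. Assume that for all sufficiently large $n$ the following holds. - Type $A$: $n\ge d+1$; $(\xi_1,\dots,\xi_n)\stackrel{d}{=}(\xi_{\sigma(1)},\dots,\xi_{\sigma(n)})$ for every permutation $\sigma$ of $\{1,\dots,n\}$; $S_n=0$ a.s.; any $d$ of the vectors $S_1,\dots,S_{n-1}$ are a.s. linearly independent. Put $H_{n,d}=\operatorname{Conv}(S_1,\dots,S_{n-1})$. - Type $B$: $n\ge d$; $(\xi_1,\dots,\xi_n)\stackrel{d}{=}(\varepsilon_1\xi_{\sigma(1)},\dots,\varepsilon_n\xi_{\sigma(n)})$ for every permutation $\sigma$ and all $\varepsilon_1,\dots,\varepsilon_n\in\{-1,1\}$; any $d$ of the vectors $S_1,\dots,S_n$ are a.s. linearly independent. Put $H_{n,d}=\operatorname{Conv}(S_1,\dots,S_n)$.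 - Type $D$: $n\ge\max\{2,d\}$; the same equality in distribution holds for every permutation $\sigma$ and all $\varepsilon_1,\dots,\varepsilon_n\in\{-1,1\}$ with $\varepsilon_1\cdots\varepsilon_n=1$; with $S_n^*=S_{n-1}-\xi_n$, any $d$ vectors from either of the collections $S_1,\dots,S_n$ and $S_1,\dots,S_{n-1},S_n^*$ are a.s. linearly independent. Put $H_{n,d}=\operatorname{Conv}(S_1,\dots,S_n,S_n^*)$. Then the following hold. 1. If for some $a\in\mathbb R$ we have $d(n)=u\log n+a\sqrt{u\log n}+o(\sqrt{\log n})$ as $n\to\infty$, then $$\lim_{n\to\infty}\mathbb P[0\notin H_{n,d(n)}]=\frac1{\sqrt{2\pi}}\int_{-\infty}^a e^{-t^2/2}\,dt .$$ 2. (Phase transition at $d\approx u\log n$.) If $\limsup_{n\to\infty}\frac{d(n)}{u\log n}<1$, then $\lim_{n\to\infty}\mathbb P[0\notin H_{n,d(n)}]=0$; if $\liminf_{n\to\infty}\frac{d(n)}{u\log n}>1$, then $\lim_{n\to\infty}\mathbb P[0\notin H_{n,d(n)}]=1$. -/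

import Mathlib

open Filter Topology MeasureTheory ProbabilityTheory

noncomputable section

namespace ConvHullWalk

/-- The three series of finite reflection groups: `A` stands for `A_{n-1}` (permutations of the
increments), `B` for `B_n` (permutations and sign changes), `D` for `D_n` (permutations and an even
number of sign changes). -/
inductive ReflType where
  | A
  | B
  | D

/-- The constant `u`, equal to `1` for type `A` and to `1/2` for types `B` and `D`. -/
def ReflType.u : ReflType → ℝ
  | .A => 1
  | .B => 1 / 2
  | .D => 1 / 2

section Deterministic

variable {E : Type*} [AddCommGroup E] {n : ℕ}

/-- `partialSum x k` is `S_k = x_1 + ... + x_k`. The tuple `(x_1, ..., x_n)` is indexed from `0`,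
so `x_i` is the entry with index `i - 1`. -/
def partialSum (x : Fin n → E) (k : ℕ) : E :=
  ∑ i ∈ Finset.univ.filter (fun i : Fin n => (i : ℕ) < k), x i

/-- The tuple `(x_1, ..., x_{n-1}, -x_n)`. -/
def flipLast (x : Fin n → E) : Fin n → E :=
  fun i => if (i : ℕ) + 1 = n then -x i else x i

/-- `S_n^* = x_1 + ... + x_{n-1} - x_n`. -/
def starSum (x : Fin n → E) : E :=
  partialSum (flipLast x) n

variable [Module ℝ E]

/-- The convex hull `H_{n,d}` attached to the increments `x_1, ..., x_n`:
* type `A`: the hull of `S_1, ..., S_{n-1}`;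
* type `B`: the hull of `S_1, ..., S_n`;
* type `D`: the hull of `S_1, ..., S_n, S_n^*`. -/
def hull : ReflType → (Fin n → E) → Set E
  | .A, x => convexHull ℝ (partialSum x '' Set.Icc 1 (n - 1))
  | .B, x => convexHull ℝ (partialSum x '' Set.Icc 1 n)
  | .D, x => convexHull ℝ (insert (starSum x) (partialSum x '' Set.Icc 1 n))

end Deterministic

section Random

variable {Ω : Type*} [MeasurableSpace Ω] {n d : ℕ}

/-- General position: any `d` vectors among the partial sums `S_1, ..., S_m` of the random tuple
`ξ` of vectors in `ℝ^d` are almost surely linearly independent. -/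
def GeneralPosition (P : Measure Ω) (ξ : Ω → Fin n → EuclideanSpace ℝ (Fin d)) (m : ℕ) : Prop :=
  ∀ I : Finset ℕ, I ⊆ Finset.Icc 1 m → I.card = d →
    ∀ᵐ ω ∂P, LinearIndependent ℝ (fun k : I => partialSum (ξ ω) (k : ℕ))

/-- Type `A_{n-1}`: exchangeable increments of a random walk bridge in general position. -/
structure IsTypeA (P : Measure Ω) (ξ : Ω → Fin n → EuclideanSpace ℝ (Fin d)) : Prop where
  measurable : Measurable ξ
  exchangeable : ∀ σ : Equiv.Perm (Fin n), IdentDistrib ξ (fun ω i => ξ ω (σ i)) P P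
  bridge : ∀ᵐ ω ∂P, partialSum (ξ ω) n = 0
  le : d + 1 ≤ n
  general : GeneralPosition P ξ (n - 1)

/-- Type `B_n`: symmetrically exchangeable increments of a random walk in general position. -/
structure IsTypeB (P : Measure Ω) (ξ : Ω → Fin n → EuclideanSpace ℝ (Fin d)) : Prop where
  measurable : Measurable ξ
  exchangeable : ∀ (σ : Equiv.Perm (Fin n)) (ε : Fin n → ℤˣ),
    IdentDistrib ξ (fun ω i => ε i • ξ ω (σ i)) P P
  le : d ≤ n
  general : GeneralPosition P ξ n

/-- Type `D_n`: the law of the increments is invariant under permutations combined with an even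
number of sign changes, and both `S_1, ..., S_n` and `S_1, ..., S_{n-1}, S_n^*` (which are the
partial sums of the increments with the last sign flipped) are in general position. -/
structure IsTypeD (P : Measure Ω) (ξ : Ω → Fin n → EuclideanSpace ℝ (Fin d)) : Prop where
  measurable : Measurable ξ
  exchangeable : ∀ (σ : Equiv.Perm (Fin n)) (ε : Fin n → ℤˣ), ∏ i, ε i = 1 →
    IdentDistrib ξ (fun ω i => ε i • ξ ω (σ i)) P P
  le : max 2 d ≤ n
  general : GeneralPosition P ξ n
  general_star : GeneralPosition P (fun ω => flipLast (ξ ω)) n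

/-- The assumptions on the increments in each of the three cases. -/
def Admissible (T : ReflType) (P : Measure Ω) (ξ : Ω → Fin n → EuclideanSpace ℝ (Fin d)) : Prop :=
  match T with
  | .A => IsTypeA P ξ
  | .B => IsTypeB P ξ
  | .D => IsTypeD P ξ

/-- The non-absorption probability `P[0 ∉ H_{n,d}]`. -/
def nonAbsorption (T : ReflType) (P : Measure Ω)
    (ξ : Ω → Fin n → EuclideanSpace ℝ (Fin d)) : ℝ :=
  P.real {ω | (0 : EuclideanSpace ℝ (Fin d)) ∉ hull T (ξ ω)}

end Random

end ConvHullWalk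

end

namespace ConvHullWalk

/-! The non-absorption probability is computed exactly in types A and B by counting Weyl chambers,
and bounded on both sides in type D; the limit theorems then concern sums of independent Bernoulli
variables.

Abel summation turns strictly positive relations between partial sums into relations `∑ c_i ξ_i = 0`
with `c` positive and strictly decreasing. In general position the origin lies in the hull exactly
when such a relation exists (`SumsIndep.zero_mem_iff`). Hence a signed permutation `g` of the
increments absorbs the origin exactly when the space `L` of linear relations meets the chamber of
`g`. For a bridge, `∑ ξ_i = 0` makes coefficients matter only up to a common constant, which gives
the same picture for the braid arrangement.

General position makes `L` complementary to all `d`-dimensional flats of the arrangement, and the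
number of chambers met by such an `L` depends only on `d` and the arrangement. Deleting the first
coordinate gives a recursion (`numRegions_forms_succ`) which, divided by the total number of
chambers, is the recursion for `P[X ≥ d]`, where `X` is a sum of independent Bernoulli variables
with parameters `1/(2+kj)`, `j ≥ 1`; here `k = 1` in type A and `k = 2` in type B
(`IsGeneric.numRegions_eq`). The count is deterministic, so averaging over the group gives `P[0 ∉ H]
= P[X < d]`. In type D the hull absorbs the origin when one of two type B hulls does, and
inclusion–exclusion squeezes the probability (`IsTypeD.nonAbsorption_bounds`).

The parameters sum to `u log n + O(1)` and their squares have bounded sum, so Poisson approximation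
of characteristic functions yields a central limit theorem (`tendsto_bernoulliSum_Iio`). The phase
transition follows by comparing `d` with Gaussian thresholds. -/

theorem ncard_image_eq_of_eq_iff {α β γ : Type*} {S : Set α} {f : α → β} {g : α → γ}
    (h : ∀ p ∈ S, ∀ q ∈ S, f p = f q ↔ g p = g q) : (f '' S).ncard = (g '' S).ncard := by
  classical
  refine Set.ncard_congr (fun b hb => g (Classical.choose hb)) ?_ ?_ ?_
  · intro b hb
    exact ⟨_, (Classical.choose_spec hb).1, rfl⟩
  · intro b c hb hc hbc
    have h1 := Classical.choose_spec hb
    have h2 := Classical.choose_spec hc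
    rw [← h1.2, ← h2.2]
    exact (h _ h1.1 _ h2.1).2 hbc
  · rintro _ ⟨p, hp, rfl⟩
    have hb : f p ∈ f '' S := ⟨p, hp, rfl⟩
    have h1 := Classical.choose_spec hb
    exact ⟨f p, hb, (h _ h1.1 _ hp).1 h1.2⟩

/-! ### Deletion and restriction for the chambers met by a subspace. -/

section Arrangement

variable {V : Type*} [AddCommGroup V] [Module ℝ V]

/-- The points of the subspace `L` off all the hyperplanes `w = 0`, `w ∈ W`. -/
def regularPoints (L : Submodule ℝ V) (W : Set (V →ₗ[ℝ] ℝ)) : Set V :=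
  {p | p ∈ L ∧ ∀ w ∈ W, w p ≠ 0}

/-- The forms in `W` that are positive at `p`. -/
def posForms (W : Set (V →ₗ[ℝ] ℝ)) (p : V) : Set (V →ₗ[ℝ] ℝ) :=
  {w | w ∈ W ∧ 0 < w p}

/-- The number of chambers of the hyperplane arrangement `W` met by the subspace `L`. -/
noncomputable def numRegions (L : Submodule ℝ V) (W : Set (V →ₗ[ℝ] ℝ)) : ℕ :=
  (posForms W '' regularPoints L W).ncard

theorem posForms_eq_iff {W : Set (V →ₗ[ℝ] ℝ)} {p q : V} :
    posForms W p = posForms W q ↔ ∀ w ∈ W, (0 < w p ↔ 0 < w q) := by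
  constructor
  · intro h w hw
    have := Set.ext_iff.1 h w
    simpa [posForms, hw] using this
  · intro h
    ext w
    exact and_congr_right fun hw => h w hw

theorem finite_posForms_image {W : Set (V →ₗ[ℝ] ℝ)} (hW : W.Finite) (S : Set V) :
    (posForms W '' S).Finite := by
  refine hW.finite_subsets.subset ?_
  rintro _ ⟨p, _, rfl⟩
  exact fun w hw => hw.1

theorem eventually_sameSide {W : Set (V →ₗ[ℝ] ℝ)} (hW : W.Finite) {p : V}
    (hp : ∀ w ∈ W, w p ≠ 0) (v : V) :
    ∀ᶠ δ in 𝓝 (0 : ℝ), ∀ w ∈ W, w (p + δ • v) ≠ 0 ∧ (0 < w (p + δ • v) ↔ 0 < w p) := by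
  rw [Filter.eventually_all_finite hW]
  intro w hw
  have hc : Tendsto (fun δ : ℝ => w (p + δ • v)) (𝓝 0) (𝓝 (w p)) := by
    have : Continuous (fun δ : ℝ => w p + δ * w v) := by fun_prop
    simpa using this.tendsto 0
  rcases lt_or_gt_of_ne (hp w hw) with h | h
  · filter_upwards [hc.eventually (gt_mem_nhds h)] with δ hδ
    exact ⟨hδ.ne, by constructor <;> intro h' <;> linarith⟩
  · filter_upwards [hc.eventually (lt_mem_nhds h)] with δ hδ
    exact ⟨hδ.ne', by constructor <;> intro h' <;> linarith⟩

theorem exists_sameSide {L : Submodule ℝ V} {W : Set (V →ₗ[ℝ] ℝ)} (hW : W.Finite) {p v : V}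
    (hp : p ∈ regularPoints L W) (hv : v ∈ L) :
    ∃ δ : ℝ, 0 < δ ∧ p + δ • v ∈ regularPoints L W ∧ posForms W (p + δ • v) = posForms W p := by
  have h := (eventually_sameSide hW hp.2 v).filter_mono (nhdsWithin_le_nhds (s := Set.Ioi 0))
  obtain ⟨δ, hδ, hpos⟩ := (h.and self_mem_nhdsWithin).exists
  exact ⟨δ, hpos, ⟨L.add_mem hp.1 (L.smul_mem _ hv), fun w hw => (hδ w hw).1⟩,
    posForms_eq_iff.2 fun w hw => (hδ w hw).2⟩

/-- Deletion–restriction: a chamber of `W` is counted twice after adding `w` exactly when `w` takes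
both signs on its trace in `L`. By convexity this trace then meets `ker w`, so the excess is the
number of chambers met by `L ⊓ ker w`. -/
theorem numRegions_insert {L : Submodule ℝ V} {W : Set (V →ₗ[ℝ] ℝ)} (hW : W.Finite)
    {w : V →ₗ[ℝ] ℝ} (hw : ∃ v ∈ L, w v ≠ 0) :
    numRegions L (insert w W) = numRegions L W + numRegions (L ⊓ LinearMap.ker w) W := by
  obtain ⟨v, hvL, hv⟩ : ∃ v ∈ L, 0 < w v := by
    obtain ⟨v, hvL, hv⟩ := hw
    rcases lt_or_gt_of_ne hv with h | h
    · exact ⟨-v, L.neg_mem hvL, by simpa using h⟩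
    · exact ⟨v, hvL, h⟩
  set A := regularPoints L W with hA
  set Sp := {p | p ∈ A ∧ 0 < w p} with hSp
  set Sn := {p | p ∈ A ∧ w p < 0} with hSn
  have hreg : regularPoints L (insert w W) = Sp ∪ Sn := by
    ext p
    simp only [regularPoints, Set.mem_insert_iff, forall_eq_or_imp, hSp, hSn, hA]
    constructor
    · rintro ⟨h1, h2, h3⟩
      rcases lt_or_gt_of_ne h2 with h | h
      · exact Or.inr ⟨⟨h1, h3⟩, h⟩
      · exact Or.inl ⟨⟨h1, h3⟩, h⟩
    · rintro (⟨⟨h1, h3⟩, h⟩ | ⟨⟨h1, h3⟩, h⟩)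
      · exact ⟨h1, h.ne', h3⟩
      · exact ⟨h1, h.ne, h3⟩
  have hp1 : (posForms (insert w W) '' Sp).ncard = (posForms W '' Sp).ncard := by
    refine ncard_image_eq_of_eq_iff fun p hp q hq => ?_
    rw [posForms_eq_iff, posForms_eq_iff, Set.forall_mem_insert]
    simp [hp.2, hq.2]
  have hn1 : (posForms (insert w W) '' Sn).ncard = (posForms W '' Sn).ncard := by
    refine ncard_image_eq_of_eq_iff fun p hp q hq => ?_
    rw [posForms_eq_iff, posForms_eq_iff, Set.forall_mem_insert]
    simp [not_lt.2 hp.2.le, not_lt.2 hq.2.le]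
  have hdisj : Disjoint (posForms (insert w W) '' Sp) (posForms (insert w W) '' Sn) := by
    rw [Set.disjoint_left]
    rintro _ ⟨p, hp, rfl⟩ ⟨q, hq, hpq⟩
    have := (posForms_eq_iff.1 hpq w (Set.mem_insert _ _)).2 hp.2
    exact absurd hq.2 (not_lt.2 this.le)
  have hunion : posForms W '' Sp ∪ posForms W '' Sn = posForms W '' A := by
    rw [← Set.image_union]
    refine Set.Subset.antisymm (Set.image_mono ?_) ?_
    · rintro p (hp | hp) <;> exact hp.1
    · rintro _ ⟨p, hp, rfl⟩
      rcases lt_trichotomy (w p) 0 with h | h | h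
      · exact ⟨p, Or.inr ⟨hp, h⟩, rfl⟩
      -- A point on the new hyperplane is pushed off it along `v` without leaving its chamber, so no
      -- chamber of `W` is lost.
      · obtain ⟨δ, hδ, h1, h2⟩ := exists_sameSide hW hp hvL
        refine ⟨_, Or.inl ⟨h1, ?_⟩, h2⟩
        simpa [h] using mul_pos hδ hv
      · exact ⟨p, Or.inl ⟨hp, h⟩, rfl⟩
  have hinter : posForms W '' Sp ∩ posForms W '' Sn =
      posForms W '' regularPoints (L ⊓ LinearMap.ker w) W := by
    refine Set.Subset.antisymm ?_ ?_
    · rintro _ ⟨⟨p, hp, rfl⟩, ⟨q, hq, hpq⟩⟩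
      have hpq := posForms_eq_iff.1 hpq
      have hside : ∀ w' ∈ W, (0 < w' p ∧ 0 < w' q) ∨ (w' p < 0 ∧ w' q < 0) := by
        intro w' hw'
        rcases lt_or_gt_of_ne (hp.1.2 w' hw') with h | h
        · refine Or.inr ⟨h, lt_of_le_of_ne (not_lt.1 fun h' => ?_) (hq.1.2 w' hw')⟩
          exact absurd ((hpq w' hw').1 h') (not_lt.2 h.le)
        · exact Or.inl ⟨h, (hpq w' hw').2 h⟩
      have hq' : 0 < -w q := neg_pos.2 hq.2
      -- Up to a positive factor, `-w q • p + w p • q` is the point where the segment from `p` to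
      -- `q` crosses `ker w`.
      have hval : ∀ w' ∈ W, (0 < w' p ∧ 0 < w' (-w q • p + w p • q)) ∨
          (w' p < 0 ∧ w' (-w q • p + w p • q) < 0) := by
        intro w' hw'
        have e : w' (-w q • p + w p • q) = -w q * w' p + w p * w' q := by simp
        rw [e]
        rcases hside w' hw' with ⟨h1, h2⟩ | ⟨h1, h2⟩
        · exact Or.inl ⟨h1, add_pos (mul_pos hq' h1) (mul_pos hp.2 h2)⟩
        · exact Or.inr ⟨h1, add_neg (mul_neg_of_pos_of_neg hq' h1)
            (mul_neg_of_pos_of_neg hp.2 h2)⟩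
      refine ⟨-w q • p + w p • q, ⟨⟨?_, ?_⟩, fun w' hw' => ?_⟩, ?_⟩
      · exact L.add_mem (L.smul_mem _ hp.1.1) (L.smul_mem _ hq.1.1)
      · change w _ = 0
        simp only [map_add, map_smul, smul_eq_mul]
        ring
      · rcases hval w' hw' with h | h
        exacts [h.2.ne', h.2.ne]
      · refine posForms_eq_iff.2 fun w' hw' => ?_
        rcases hval w' hw' with h | h
        · exact iff_of_true h.2 h.1
        · exact iff_of_false (not_lt.2 h.2.le) (not_lt.2 h.1.le)
    · rintro _ ⟨p, ⟨⟨hpL, hpw⟩, hpW⟩, rfl⟩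
      have hpw : w p = 0 := hpw
      have hp : p ∈ regularPoints L W := ⟨hpL, hpW⟩
      obtain ⟨δ, hδ, h1, h2⟩ := exists_sameSide hW hp hvL
      obtain ⟨ε, hε, h3, h4⟩ := exists_sameSide hW hp (L.neg_mem hvL)
      refine ⟨⟨_, ⟨h1, ?_⟩, h2⟩, ⟨_, ⟨h3, ?_⟩, h4⟩⟩
      · simpa [hpw] using mul_pos hδ hv
      · simpa [hpw] using mul_pos hε hv
  rw [numRegions, numRegions, numRegions, hreg, Set.image_union,
    Set.ncard_union_eq hdisj ((hW.insert w).finite_subsets.subset ?_)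
      ((hW.insert w).finite_subsets.subset ?_), hp1, hn1,
    ← Set.ncard_union_add_ncard_inter _ _ (finite_posForms_image hW _) (finite_posForms_image hW _),
    hunion, hinter]
  all_goals
    rintro _ ⟨p, _, rfl⟩
    exact fun w hw => hw.1

/-- A form proportional on `L` to one already present cuts out the same hyperplane of `L`, hence
splits no chamber. This is how walls added earlier drop out after restriction to a new wall. -/
theorem numRegions_union_of_redundant {L : Submodule ℝ V} {B W : Set (V →ₗ[ℝ] ℝ)}
    (h : ∀ w ∈ W, ∃ b ∈ B, ∃ r : ℝ, r ≠ 0 ∧ ∀ p ∈ L, w p = r * b p) :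
    numRegions L (B ∪ W) = numRegions L B := by
  have hreg : regularPoints L (B ∪ W) = regularPoints L B := by
    ext p
    refine ⟨fun hp => ⟨hp.1, fun w hw => hp.2 w (Or.inl hw)⟩, fun hp => ⟨hp.1, ?_⟩⟩
    rintro w (hw | hw)
    · exact hp.2 w hw
    · obtain ⟨b, hb, r, hr, hrb⟩ := h w hw
      rw [hrb p hp.1]
      exact mul_ne_zero hr (hp.2 b hb)
  rw [numRegions, numRegions, hreg]
  refine ncard_image_eq_of_eq_iff fun p hp q hq => ?_
  rw [posForms_eq_iff, posForms_eq_iff]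
  refine ⟨fun h' w hw => h' w (Or.inl hw), fun h' => ?_⟩
  rintro w (hw | hw)
  · exact h' w hw
  · obtain ⟨b, hb, r, hr, hrb⟩ := h w hw
    rw [hrb p hp.1, hrb q hq.1]
    have hpb := hp.2 b hb
    have hqb := hq.2 b hb
    have := h' b hb
    rcases lt_or_gt_of_ne hr with hr | hr
    · have e : ∀ x : ℝ, 0 < r * x ↔ x < 0 := fun x => by constructor <;> intro h <;> nlinarith
      rw [e, e]
      grind
    · rwa [mul_pos_iff_of_pos_left hr, mul_pos_iff_of_pos_left hr]

/-- Adding to an arrangement `B` a family of walls, each of which has its traces of the other walls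
among those of `B`. -/
theorem numRegions_union_walls {κ : Type*} {L : Submodule ℝ V} {B : Set (V →ₗ[ℝ] ℝ)}
    (hB : B.Finite) (w : κ → V →ₗ[ℝ] ℝ) (hL : ∀ k, ∃ v ∈ L, w k v ≠ 0)
    (hw : ∀ k k', k ≠ k' → ∃ b ∈ B, ∃ r : ℝ, r ≠ 0 ∧ ∀ p, w k p = 0 → w k' p = r * b p)
    (s : Finset κ) :
    numRegions L (B ∪ w '' s) =
      numRegions L B + ∑ k ∈ s, numRegions (L ⊓ LinearMap.ker (w k)) B := by
  classical
  induction s using Finset.induction_on with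
  | empty => simp
  | insert k s hk ih =>
    rw [Finset.coe_insert, Set.image_insert_eq, Set.union_insert,
      numRegions_insert (hB.union (s.finite_toSet.image w)) (hL k), ih, Finset.sum_insert hk,
      numRegions_union_of_redundant (L := L ⊓ LinearMap.ker (w k)) (B := B)]
    · ring
    · rintro _ ⟨k', hk', rfl⟩
      obtain ⟨b, hb, r, hr, h⟩ := hw k k' (by rintro rfl; exact hk hk')
      exact ⟨b, hb, r, hr, fun p hp => h p hp.2⟩

theorem numRegions_comap {V' : Type*} [AddCommGroup V'] [Module ℝ V'] (π : V →ₗ[ℝ] V')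
    (L : Submodule ℝ V) (W : Set (V' →ₗ[ℝ] ℝ)) :
    numRegions L ((fun w => w.comp π) '' W) = numRegions (L.map π) W := by
  have h1 : regularPoints (L.map π) W = π '' regularPoints L ((fun w => w.comp π) '' W) := by
    ext q
    constructor
    · rintro ⟨⟨p, hp, rfl⟩, hq⟩
      refine ⟨p, ⟨hp, ?_⟩, rfl⟩
      rintro _ ⟨w, hw, rfl⟩
      exact hq w hw
    · rintro ⟨p, ⟨hp, hpW⟩, rfl⟩
      exact ⟨⟨p, hp, rfl⟩, fun w hw => hpW _ ⟨w, hw, rfl⟩⟩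
  rw [numRegions, numRegions, h1, Set.image_image]
  refine ncard_image_eq_of_eq_iff fun p _ q _ => ?_
  rw [posForms_eq_iff, posForms_eq_iff]
  simp

end Arrangement

/-! ### Laws of Bernoulli sums. -/

/-- The law of a sum of independent Bernoulli variables with parameters `q 0, ..., q (m - 1)`. -/
noncomputable def bernoulliSum (q : ℕ → ℝ) : ℕ → Measure ℝ
  | 0 => Measure.dirac 0
  | m + 1 => ENNReal.ofReal (1 - q m) • bernoulliSum q m +
      ENNReal.ofReal (q m) • (bernoulliSum q m).map (· + 1)

section BernoulliSum

variable {q : ℕ → ℝ}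

theorem isProbabilityMeasure_bernoulliSum (hq : ∀ m, q m ∈ Set.Icc (0 : ℝ) 1) (m : ℕ) :
    IsProbabilityMeasure (bernoulliSum q m) := by
  induction m with
  | zero => rw [bernoulliSum]; infer_instance
  | succ m ih =>
    constructor
    have h1 : IsProbabilityMeasure ((bernoulliSum q m).map (· + 1)) :=
      Measure.isProbabilityMeasure_map (by fun_prop)
    rw [bernoulliSum]
    simp only [Measure.add_apply, Measure.smul_apply, smul_eq_mul, measure_univ, mul_one]
    rw [← ENNReal.ofReal_add (by linarith [(hq m).2]) (hq m).1]
    simp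

theorem bernoulliSum_succ_Iio (hq : ∀ m, q m ∈ Set.Icc (0 : ℝ) 1) (m : ℕ) (x : ℝ) :
    (bernoulliSum q (m + 1)).real (Set.Iio x) = (1 - q m) * (bernoulliSum q m).real (Set.Iio x) +
      q m * (bernoulliSum q m).real (Set.Iio (x - 1)) := by
  have := isProbabilityMeasure_bernoulliSum hq m
  have h1 : IsProbabilityMeasure ((bernoulliSum q m).map (· + 1)) :=
    Measure.isProbabilityMeasure_map (by fun_prop)
  have e : ((bernoulliSum q m).map (· + 1)).real (Set.Iio x) =
      (bernoulliSum q m).real (Set.Iio (x - 1)) := by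
    rw [map_measureReal_apply (by fun_prop) measurableSet_Iio]
    congr 1
    ext y
    simp [lt_sub_iff_add_lt]
  rw [bernoulliSum, ← e]
  simp only [Measure.real, Measure.add_apply, Measure.smul_apply, smul_eq_mul]
  rw [ENNReal.toReal_add (by finiteness) (by finiteness), ENNReal.toReal_mul, ENNReal.toReal_mul,
    ENNReal.toReal_ofReal (by linarith [(hq m).2]), ENNReal.toReal_ofReal (hq m).1]

theorem bernoulliSum_Iio_of_nonpos (hq : ∀ m, q m ∈ Set.Icc (0 : ℝ) 1) (m : ℕ) :
    ∀ x : ℝ, x ≤ 0 → (bernoulliSum q m).real (Set.Iio x) = 0 := by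
  induction m with
  | zero =>
    intro x hx
    simp [bernoulliSum, Measure.real, hx]
  | succ m ih =>
    intro x hx
    rw [bernoulliSum_succ_Iio hq, ih x hx, ih (x - 1) (by linarith)]
    simp

/-- Since `q 0 = 0`, the first of the `m + 1` variables contributes nothing and the sum is at most
`m`. -/
theorem bernoulliSum_Iio_of_le (hq : ∀ m, q m ∈ Set.Icc (0 : ℝ) 1) (h0 : q 0 = 0) (m : ℕ) :
    ∀ x : ℝ, (m : ℝ) + 1 ≤ x → (bernoulliSum q (m + 1)).real (Set.Iio x) = 1 := by
  induction m with
  | zero =>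
    intro x hx
    have : (0 : ℝ) < x := by norm_num at hx; linarith
    rw [bernoulliSum_succ_Iio hq, h0]
    simp [bernoulliSum, Measure.real, this]
  | succ m ih =>
    intro x hx
    push_cast at hx
    rw [bernoulliSum_succ_Iio hq, ih x (by linarith), ih (x - 1) (by linarith)]
    ring

end BernoulliSum

/-! ### Reflection arrangements and their generic sections. -/

section SignedBraid

variable {S : Finset ℝ} {m d : ℕ}

/-- The forms `c_i` and `c_i - s c_j`, `s ∈ S`, of the arrangement on `ℝ^m` with sign set `S`. -/
def forms (S : Finset ℝ) (m : ℕ) : Set ((Fin m → ℝ) →ₗ[ℝ] ℝ) :=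
  {w | (∃ i, w = LinearMap.proj i) ∨
    ∃ i j, ∃ s ∈ S, i < j ∧ w = LinearMap.proj i - s • LinearMap.proj j}

/-- Forgetting the first coordinate. -/
def tailMap (m : ℕ) : (Fin (m + 1) → ℝ) →ₗ[ℝ] (Fin m → ℝ) :=
  LinearMap.funLeft ℝ ℝ Fin.succ

@[simp]
theorem tailMap_apply (c : Fin (m + 1) → ℝ) (i : Fin m) : tailMap m c i = c i.succ := rfl

theorem tailMap_cons (a : ℝ) (y : Fin m → ℝ) :
    tailMap m (Fin.cons a y : Fin (m + 1) → ℝ) = y := by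
  ext i; simp

/-- The value of the first coordinate on a wall, as a form in the others. -/
def wallValue : Option (Fin m × S) → (Fin m → ℝ) →ₗ[ℝ] ℝ
  | none => 0
  | some k => (k.2 : ℝ) • LinearMap.proj k.1

/-- The forms of the arrangement that involve the first coordinate. -/
def wall (k : Option (Fin m × S)) : (Fin (m + 1) → ℝ) →ₗ[ℝ] ℝ :=
  LinearMap.proj 0 - (wallValue k).comp (tailMap m)

theorem wall_apply (k : Option (Fin m × S)) (c : Fin (m + 1) → ℝ) :
    wall k c = c 0 - wallValue k (tailMap m c) := rfl

/-- The index set of the walls has `1 + |S| m` elements: `none` stands for the first coordinate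
itself, `some (j, s)` for its difference from `s` times the coordinate `j` of the tail. This number
is the source of the Bernoulli parameters. -/
theorem forms_succ (S : Finset ℝ) (m : ℕ) :
    forms S (m + 1) = (fun w => w.comp (tailMap m)) '' forms S m ∪
      wall '' ((Finset.univ : Finset (Option (Fin m × S))) : Set (Option (Fin m × S))) := by
  ext w
  simp only [forms, Set.mem_union, Set.mem_image, Finset.coe_univ, Set.mem_univ, true_and]
  constructor
  · rintro (⟨i, rfl⟩ | ⟨i, j, s, hs, hij, rfl⟩)
    · refine Fin.cases ?_ (fun i => ?_) i
      · exact Or.inr ⟨none, by ext; simp [wall, wallValue]⟩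
      · exact Or.inl ⟨_, Or.inl ⟨i, rfl⟩, rfl⟩
    · obtain ⟨j, rfl⟩ := Fin.exists_succ_eq.2 (Fin.ne_zero_of_lt hij)
      induction i using Fin.cases with
      | zero => exact Or.inr ⟨some (j, ⟨s, hs⟩), rfl⟩
      | succ i => exact Or.inl ⟨_, Or.inr ⟨i, j, s, hs, Fin.succ_lt_succ_iff.1 hij, rfl⟩, rfl⟩
  · rintro (⟨_, (⟨i, rfl⟩ | ⟨i, j, s, hs, hij, rfl⟩), rfl⟩ | ⟨k, rfl⟩)
    · exact Or.inl ⟨i.succ, rfl⟩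
    · exact Or.inr ⟨i.succ, j.succ, s, hs, Fin.succ_lt_succ_iff.2 hij, rfl⟩
    · rcases k with _ | ⟨j, s⟩
      · exact Or.inl ⟨0, by ext; simp [wall, wallValue]⟩
      · exact Or.inr ⟨0, j.succ, s, s.2, Fin.succ_pos j, rfl⟩

theorem finite_forms (S : Finset ℝ) (m : ℕ) : (forms S m).Finite := by
  induction m with
  | zero =>
    refine Set.Finite.subset (Set.finite_empty) ?_
    rintro w (⟨i, _⟩ | ⟨i, _⟩) <;> exact i.elim0
  | succ m ih =>
    rw [forms_succ]
    exact (ih.image _).union ((Finset.finite_toSet _).image _)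

/-- A finite multiplicative set of signs containing `1`. -/
structure IsSignSet (S : Finset ℝ) : Prop where
  one_mem : 1 ∈ S
  mul_mem : ∀ s ∈ S, ∀ t ∈ S, s * t ∈ S
  eq_or : ∀ s ∈ S, s = 1 ∨ s = -1

theorem IsSignSet.mul_self (hS : IsSignSet S) {s : ℝ} (hs : s ∈ S) : s * s = 1 := by
  rcases hS.eq_or s hs with rfl | rfl <;> norm_num

theorem IsSignSet.ne_zero (hS : IsSignSet S) {s : ℝ} (hs : s ∈ S) : s ≠ 0 := by
  rcases hS.eq_or s hs with rfl | rfl <;> norm_num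

/-- The trace of a wall on another one is a wall of the smaller arrangement. -/
theorem wall_trace (hS : IsSignSet S) (k k' : Option (Fin m × S)) (hk : k ≠ k') :
    ∃ b ∈ (fun w => w.comp (tailMap m)) '' forms S m, ∃ r : ℝ, r ≠ 0 ∧
      ∀ p, wall k p = 0 → wall k' p = r * b p := by
  suffices h : ∃ b ∈ forms S m, ∃ r : ℝ, r ≠ 0 ∧
      ∀ y, wallValue k y - wallValue k' y = r * b y by
    obtain ⟨b, hb, r, hr, h⟩ := h
    refine ⟨_, ⟨b, hb, rfl⟩, r, hr, fun p hp => ?_⟩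
    rw [wall_apply, sub_eq_zero] at hp
    rw [wall_apply, hp, h]
    rfl
  rcases k with _ | ⟨j, s, hs⟩ <;> rcases k' with _ | ⟨j', s', hs'⟩
  · exact absurd rfl hk
  · exact ⟨_, Or.inl ⟨j', rfl⟩, -s', neg_ne_zero.2 (hS.ne_zero hs'), fun y => by simp [wallValue]⟩
  · exact ⟨_, Or.inl ⟨j, rfl⟩, s, hS.ne_zero hs, fun y => by simp [wallValue]⟩
  -- For distinct indices `s * s = 1` gives `s y_j - s' y_j' = s (y_j - s s' y_j')`, again a form of
  -- the arrangement because signs multiply. For equal indices the signs differ, and a nonzero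
  -- multiple of `y_j` remains.
  · rcases lt_trichotomy j j' with h | rfl | h
    · refine ⟨_, Or.inr ⟨j, j', s * s', hS.mul_mem s hs s' hs', h, rfl⟩, s, hS.ne_zero hs,
        fun y => ?_⟩
      simp only [wallValue, LinearMap.smul_apply, LinearMap.proj_apply, LinearMap.sub_apply,
        smul_eq_mul]
      linear_combination (s' * y j') * hS.mul_self hs
    · refine ⟨_, Or.inl ⟨j, rfl⟩, s - s', sub_ne_zero.2 (fun h => hk (by subst h; rfl)),
        fun y => ?_⟩
      simp only [wallValue, LinearMap.smul_apply, LinearMap.proj_apply, smul_eq_mul]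
      ring
    · refine ⟨_, Or.inr ⟨j', j, s' * s, hS.mul_mem s' hs' s hs, h, rfl⟩, -s',
        neg_ne_zero.2 (hS.ne_zero hs'), fun y => ?_⟩
      simp only [wallValue, LinearMap.smul_apply, LinearMap.proj_apply, LinearMap.sub_apply,
        smul_eq_mul]
      linear_combination (-s * y j) * hS.mul_self hs'

theorem numRegions_forms_succ (hS : IsSignSet S) {L : Submodule ℝ (Fin (m + 1) → ℝ)}
    (hL : ∀ k : Option (Fin m × S), ∃ v ∈ L, wall k v ≠ 0) :
    numRegions L (forms S (m + 1)) = numRegions (L.map (tailMap m)) (forms S m) +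
      ∑ k : Option (Fin m × S),
        numRegions ((L ⊓ LinearMap.ker (wall k)).map (tailMap m)) (forms S m) := by
  rw [forms_succ, numRegions_union_walls ((finite_forms S m).image _) _ hL (wall_trace hS)]
  simp only [numRegions_comap]

/-- The point with parameters `t` of the flat that is given by the blocks `f` and the signs `ε`. -/
def flatPoint (f : Fin m → Option (Fin d)) (ε : Fin m → ℝ) (t : Fin d → ℝ) : Fin m → ℝ :=
  fun i => ε i * (f i).elim 0 t

/-- The subspace `L` is complementary to all `d`-dimensional flats of the arrangement. -/
def IsGeneric (S : Finset ℝ) (d : ℕ) (L : Submodule ℝ (Fin m → ℝ)) : Prop :=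
  ∀ (f : Fin m → Option (Fin d)) (ε : Fin m → ℝ), (∀ i, ε i ∈ S) → (∀ a, ∃ i, f i = some a) →
    (∀ t, flatPoint f ε t ∈ L → t = 0) ∧ ∀ v, ∃ t, v - flatPoint f ε t ∈ L

theorem flatPoint_cons (f : Fin m → Option (Fin d)) (ε : Fin m → ℝ) (t : Fin d → ℝ)
    (a : Option (Fin d)) (e : ℝ) :
    flatPoint (Fin.cons a f : Fin (m + 1) → Option (Fin d)) (Fin.cons e ε : Fin (m + 1) → ℝ) t =
      (Fin.cons (e * a.elim 0 t) (flatPoint f ε t) : Fin (m + 1) → ℝ) := by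
  ext i
  induction i using Fin.cases <;> simp [flatPoint]

theorem cons_tailMap (c : Fin (m + 1) → ℝ) :
    (Fin.cons (c 0) (tailMap m c) : Fin (m + 1) → ℝ) = c := by
  ext i
  induction i using Fin.cases <;> simp

/-- A flat lifts into the wall `k` by letting the new coordinate join the zero block, or the block
of `j` with sign `s * ε j`. The number of parameters stays `d`. -/
theorem exists_flatPoint_wall (hS : IsSignSet S) (k : Option (Fin m × S))
    (f : Fin m → Option (Fin d)) (ε : Fin m → ℝ) (hε : ∀ i, ε i ∈ S)
    (hf : ∀ a, ∃ i, f i = some a) :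
    ∃ (f' : Fin (m + 1) → Option (Fin d)) (ε' : Fin (m + 1) → ℝ), (∀ i, ε' i ∈ S) ∧
      (∀ a, ∃ i, f' i = some a) ∧
      ∀ t, flatPoint f' ε' t = (Fin.cons (wallValue k (flatPoint f ε t)) (flatPoint f ε t) :
        Fin (m + 1) → ℝ) := by
  have hf' : ∀ b : Option (Fin d), ∀ a, ∃ i,
      (Fin.cons b f : Fin (m + 1) → Option (Fin d)) i = some a := fun b a => by
    obtain ⟨i, hi⟩ := hf a
    exact ⟨i.succ, by simpa using hi⟩
  have hε' : ∀ e ∈ S, ∀ i, (Fin.cons e ε : Fin (m + 1) → ℝ) i ∈ S := fun e he i => by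
    induction i using Fin.cases <;> simp [he, hε]
  rcases k with _ | ⟨j, s⟩
  · refine ⟨Fin.cons none f, Fin.cons 1 ε, hε' 1 hS.one_mem, hf' _, fun t => ?_⟩
    rw [flatPoint_cons]
    simp [wallValue]
  · refine ⟨Fin.cons (f j) f, Fin.cons (s * ε j) ε, hε' _ (hS.mul_mem _ s.2 _ (hε j)), hf' _,
      fun t => ?_⟩
    rw [flatPoint_cons]
    simp [wallValue, flatPoint, mul_assoc]

/-- Both `L` and its section by the wall are tested against flats lying in that wall, and `tailMap`
identifies the wall with the smaller space. -/
theorem IsGeneric.wall_section (hS : IsSignSet S) {L : Submodule ℝ (Fin (m + 1) → ℝ)}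
    (hL : IsGeneric S d L) (k : Option (Fin m × S)) :
    IsGeneric S d ((L ⊓ LinearMap.ker (wall k)).map (tailMap m)) := by
  intro f ε hε hf
  obtain ⟨f', ε', hε', hf', h⟩ := exists_flatPoint_wall hS k f ε hε hf
  obtain ⟨h1, h2⟩ := hL f' ε' hε' hf'
  constructor
  · rintro t ⟨p, ⟨hpL, hpw⟩, hpt⟩
    refine h1 t ?_
    have hpw : wall k p = 0 := hpw
    rw [wall_apply, sub_eq_zero] at hpw
    rw [h, ← hpt, ← hpw, cons_tailMap]
    exact hpL
  · intro v
    obtain ⟨t, ht⟩ := h2 (Fin.cons (wallValue k v) v)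
    refine ⟨t, _, ⟨ht, ?_⟩, ?_⟩
    · change wall k _ = 0
      rw [h, wall_apply, map_sub, tailMap_cons, tailMap_cons]
      simp
    · rw [h, map_sub, tailMap_cons, tailMap_cons]

/-- Making the first coordinate a block of its own lifts a `d`-dimensional flat to its full
preimage, a flat of dimension `d + 1`; complementarity of `L` to the preimage descends to the
projection. -/
theorem IsGeneric.projection (hS : IsSignSet S) {L : Submodule ℝ (Fin (m + 1) → ℝ)}
    (hL : IsGeneric S (d + 1) L) : IsGeneric S d (L.map (tailMap m)) := by
  intro f ε hε hf
  have key : ∀ t₀ t, flatPoint (Fin.cons (some 0) (fun i => (f i).map Fin.succ) :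
      Fin (m + 1) → Option (Fin (d + 1))) (Fin.cons 1 ε : Fin (m + 1) → ℝ)
        (Fin.cons t₀ t : Fin (d + 1) → ℝ) =
      (Fin.cons t₀ (flatPoint f ε t) : Fin (m + 1) → ℝ) := fun t₀ t => by
    rw [flatPoint_cons]
    congr 1
    · simp
    · ext i
      rcases h : f i <;> simp [flatPoint, h]
  obtain ⟨h1, h2⟩ := hL (Fin.cons (some 0) (fun i => (f i).map Fin.succ)) (Fin.cons 1 ε)
    (fun i => by induction i using Fin.cases <;> simp [hS.one_mem, hε])
    (fun a => by
      induction a using Fin.cases with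
      | zero => exact ⟨0, rfl⟩
      | succ a =>
        obtain ⟨i, hi⟩ := hf a
        exact ⟨i.succ, by simp [hi]⟩)
  constructor
  · rintro t ⟨p, hpL, hpt⟩
    have := h1 (Fin.cons (p 0) t) (by rw [key, ← hpt, cons_tailMap]; exact hpL)
    ext i
    simpa using congrFun this i.succ
  · intro v
    obtain ⟨t, ht⟩ := h2 (Fin.cons 0 v)
    refine ⟨fun i => t i.succ, _, ht, ?_⟩
    have e : t = (Fin.cons (t 0) (fun i => t i.succ) : Fin (d + 1) → ℝ) := by
      ext i
      induction i using Fin.cases <;> simp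
    rw [e, key, map_sub, tailMap_cons, tailMap_cons]
    simp

theorem isGeneric_zero_iff (hS : IsSignSet S) {L : Submodule ℝ (Fin m → ℝ)} :
    IsGeneric S 0 L ↔ L = ⊤ := by
  constructor
  · intro h
    refine Submodule.eq_top_iff'.2 fun v => ?_
    obtain ⟨t, ht⟩ := (h (fun _ => none) (fun _ => 1) (fun _ => hS.one_mem)
      (fun a => a.elim0)).2 v
    have e : flatPoint (fun _ => none) (fun _ => 1) t = (0 : Fin m → ℝ) := by
      ext i; simp [flatPoint]
    simpa [e] using ht
  · rintro rfl f ε _ _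
    exact ⟨fun t _ => Subsingleton.elim _ _, fun v => ⟨0, Submodule.mem_top⟩⟩

/-- When `d ≤ m` the wall contains a `d`-dimensional flat complementary to `L`. If `L` lay in the
wall too, the two could not span the whole space. -/
theorem IsGeneric.exists_wall_ne_zero (hS : IsSignSet S) {L : Submodule ℝ (Fin (m + 1) → ℝ)}
    (hL : IsGeneric S d L) (hd : d ≤ m) (k : Option (Fin m × S)) : ∃ v ∈ L, wall k v ≠ 0 := by
  obtain ⟨f', ε', hε', hf', h⟩ := exists_flatPoint_wall hS k
    (fun i : Fin m => if h : (i : ℕ) < d then some (⟨i, h⟩ : Fin d) else none) (fun _ => 1)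
    (fun _ => hS.one_mem) (fun a => ⟨Fin.castLE hd a, by simp⟩)
  obtain ⟨t, ht⟩ := (hL f' ε' hε' hf').2 (Fin.cons 1 0)
  refine ⟨_, ht, ?_⟩
  rw [h, map_sub, wall_apply, wall_apply, tailMap_cons, tailMap_cons]
  simp

/-- Here the whole space is one of the flats, so `L` is zero. -/
theorem IsGeneric.numRegions_eq_zero (hS : IsSignSet S) {L : Submodule ℝ (Fin (m + 1) → ℝ)}
    (hL : IsGeneric S (m + 1) L) : numRegions L (forms S (m + 1)) = 0 := by
  have h : regularPoints L (forms S (m + 1)) = ∅ := by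
    rw [Set.eq_empty_iff_forall_notMem]
    rintro p ⟨hp, hpW⟩
    have := (hL some (fun _ => 1) (fun _ => hS.one_mem) (fun a => ⟨a, rfl⟩)).1 p
      (by convert hp using 1; ext i; simp [flatPoint])
    exact hpW _ (Or.inl ⟨0, rfl⟩) (by simp [this])
  simp [numRegions, h]

/-- The parameters of the Bernoulli variables attached to the arrangement. -/
noncomputable def bernoulliParam (k m : ℕ) : ℝ :=
  if m = 0 then 0 else 1 / (2 + k * m)

theorem bernoulliParam_mem (k m : ℕ) : bernoulliParam k m ∈ Set.Icc (0 : ℝ) 1 := by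
  rw [bernoulliParam]
  split_ifs
  · simp
  · refine ⟨by positivity, ?_⟩
    rw [div_le_one (by positivity)]
    nlinarith [(Nat.cast_nonneg (k * m) : (0 : ℝ) ≤ _), (Nat.cast_mul k m : ((k * m : ℕ) : ℝ) = _)]

/-- The probability that the sum of Bernoulli variables attached to the arrangement is less
than `d`. -/
noncomputable def bernoulliCdf (k m d : ℕ) : ℝ :=
  (bernoulliSum (bernoulliParam k) m).real (Set.Iio (d : ℝ))

theorem bernoulliCdf_zero_right (k m : ℕ) : bernoulliCdf k m 0 = 0 :=
  bernoulliSum_Iio_of_nonpos (bernoulliParam_mem k) m _ (by simp)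

/-- This is where the convention `bernoulliParam k 0 = 0` is needed: it matches the fact that a zero
subspace meets no chamber. -/
theorem bernoulliCdf_of_le (k : ℕ) {m d : ℕ} (h : m + 1 ≤ d) : bernoulliCdf k (m + 1) d = 1 :=
  bernoulliSum_Iio_of_le (bernoulliParam_mem k) (by simp [bernoulliParam]) m _
    (by exact_mod_cast h)

theorem bernoulliCdf_succ_succ (k m d : ℕ) :
    bernoulliCdf k (m + 1) (d + 1) = (1 - bernoulliParam k m) * bernoulliCdf k m (d + 1) +
      bernoulliParam k m * bernoulliCdf k m d := by
  rw [bernoulliCdf, bernoulliSum_succ_Iio (bernoulliParam_mem k)]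
  simp [bernoulliCdf]

/-- With `R(m, d)` for the count, projection and wall sections give `R(m+1, d+1) = R(m, d) + (1 +
|S| m) R(m, d+1)`. After division by `2 + |S| m` this is conditioning on a Bernoulli variable of
parameter `1/(2 + |S| m)`. -/
theorem IsGeneric.numRegions_eq (hS : IsSignSet S) {L : Submodule ℝ (Fin m → ℝ)}
    (hL : IsGeneric S d L) (hd : d ≤ m) :
    (numRegions L (forms S m) : ℝ) =
      (∏ j ∈ Finset.range m, (2 + (S.card : ℝ) * j)) * (1 - bernoulliCdf S.card m d) := by
  induction m generalizing d with
  | zero =>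
    obtain rfl : d = 0 := by omega
    have h1 : forms S 0 = ∅ := by
      rw [Set.eq_empty_iff_forall_notMem]
      rintro w (⟨i, _⟩ | ⟨i, _⟩) <;> exact i.elim0
    have h2 : posForms (forms S 0) '' regularPoints L (forms S 0) = {∅} := by
      have : posForms (forms S 0) = fun _ => ∅ := by
        funext p
        simp [posForms, h1]
      rw [this]
      have h0 : (regularPoints L (forms S 0)).Nonempty := ⟨0, L.zero_mem, by simp [h1]⟩
      exact h0.image_const _
    rw [numRegions, h2]
    simp [bernoulliCdf_zero_right]
  | succ m ih =>
    rcases hd.eq_or_lt with rfl | hlt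
    · rw [hL.numRegions_eq_zero hS, bernoulliCdf_of_le _ le_rfl]
      simp
    · have hd' : d ≤ m := by omega
      rw [numRegions_forms_succ hS (hL.exists_wall_ne_zero hS hd'), Finset.prod_range_succ]
      push_cast
      rw [Finset.sum_congr rfl fun k _ => ih (hL.wall_section hS k) hd']
      rw [Finset.sum_const, Finset.card_univ, Fintype.card_option, Fintype.card_prod,
        Fintype.card_fin, Fintype.card_coe, nsmul_eq_mul]
      push_cast
      -- For `d = 0` the projection is again the whole space and its codimension cannot drop, so
      -- every term has the same value and the factor is `1 + (1 + |S| m)`.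
      rcases d with _ | d
      · have h0 : IsGeneric S 0 (L.map (tailMap m)) := by
          rw [isGeneric_zero_iff hS] at hL ⊢
          rw [hL, Submodule.map_top, LinearMap.range_eq_top]
          exact fun y => ⟨Fin.cons 0 y, tailMap_cons _ _⟩
        rw [ih h0 hd', bernoulliCdf_zero_right, bernoulliCdf_zero_right]
        ring
      · rw [ih (hL.projection hS) (by omega), bernoulliCdf_succ_succ]
        have hm : m ≠ 0 := by omega
        have hne : (2 + (S.card : ℝ) * m) ≠ 0 := by positivity
        rw [bernoulliParam, if_neg hm]
        field_simp
        ring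

end SignedBraid

/-! ### Poisson approximation and the Gaussian limit. -/

section Poisson

open Complex

variable {q : ℕ → ℝ}

theorem charFun_bernoulliSum (hq : ∀ m, q m ∈ Set.Icc (0 : ℝ) 1) (m : ℕ) (t : ℝ) :
    charFun (bernoulliSum q m) t =
      ∏ j ∈ Finset.range m, (1 + (q j : ℂ) * (cexp (t * I) - 1)) := by
  induction m with
  | zero => simp [bernoulliSum]
  | succ m ih =>
    have := isProbabilityMeasure_bernoulliSum hq m
    have h1 : IsProbabilityMeasure ((bernoulliSum q m).map (· + 1)) :=
      Measure.isProbabilityMeasure_map (by fun_prop)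
    have hint : ∀ (μ : Measure ℝ) [IsProbabilityMeasure μ],
        Integrable (fun x : ℝ => cexp (t * x * I)) μ := fun μ _ => by
      refine Integrable.of_bound (by fun_prop) 1 (Eventually.of_forall fun x => ?_)
      rw [← ofReal_mul, norm_exp_ofReal_mul_I]
    rw [Finset.prod_range_succ, ← ih, bernoulliSum, charFun_apply_real,
      integral_add_measure ((hint _).smul_measure (by simp)) ((hint _).smul_measure (by simp)),
      integral_smul_measure, integral_smul_measure, ← charFun_apply_real, ← charFun_apply_real,
      charFun_map_add_const, ENNReal.toReal_ofReal (by linarith [(hq m).2]),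
      ENNReal.toReal_ofReal (hq m).1]
    simp only [real_smul, ofReal_sub, ofReal_one, RCLike.inner_apply, conj_trivial, mul_one]
    ring

theorem norm_one_add_mul_le {p : ℝ} (hp : p ∈ Set.Icc (0 : ℝ) 1) (t : ℝ) :
    ‖1 + (p : ℂ) * (cexp (t * I) - 1)‖ ≤ 1 := by
  have e : 1 + (p : ℂ) * (cexp (t * I) - 1) = ((1 - p : ℝ) : ℂ) + (p : ℂ) * cexp (t * I) := by
    push_cast; ring
  rw [e]
  refine (norm_add_le _ _).trans ?_
  rw [norm_mul, norm_exp_ofReal_mul_I, norm_real, norm_real, Real.norm_of_nonneg hp.1,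
    Real.norm_of_nonneg (by linarith [hp.2])]
  linarith

theorem norm_exp_mul_le {b : ℝ} (hb : 0 ≤ b) (t : ℝ) :
    ‖cexp ((cexp (t * I) - 1) * b)‖ ≤ 1 := by
  rw [norm_exp, Real.exp_le_one_iff, re_mul_ofReal, sub_re, exp_ofReal_mul_I_re, one_re]
  exact mul_nonpos_of_nonpos_of_nonneg (by linarith [Real.cos_le_one t]) hb

/-- Poisson approximation of a sum of Bernoulli variables, for characteristic functions. -/
theorem norm_prod_sub_exp_le (hq : ∀ m, q m ∈ Set.Icc (0 : ℝ) 1) {t : ℝ}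
    (ht : ‖cexp (t * I) - 1‖ ≤ 1) (m : ℕ) :
    ‖∏ j ∈ Finset.range m, (1 + (q j : ℂ) * (cexp (t * I) - 1)) -
        cexp ((cexp (t * I) - 1) * (∑ j ∈ Finset.range m, q j : ℝ))‖ ≤
      (∑ j ∈ Finset.range m, q j ^ 2) * ‖cexp (t * I) - 1‖ ^ 2 := by
  induction m with
  | zero => simp
  | succ m ih =>
    set z := cexp (t * I) - 1 with hz
    -- Replace one factor at a time: everything else has modulus at most `1`, and the exchanged
    -- factor costs `‖exp (q z) - 1 - q z‖ ≤ ‖q z‖ ^ 2`.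
    have e : ∏ j ∈ Finset.range (m + 1), (1 + (q j : ℂ) * z) -
        cexp (z * (∑ j ∈ Finset.range (m + 1), q j : ℝ)) =
        (∏ j ∈ Finset.range m, (1 + (q j : ℂ) * z) -
          cexp (z * (∑ j ∈ Finset.range m, q j : ℝ))) * (1 + (q m : ℂ) * z) -
        cexp (z * (∑ j ∈ Finset.range m, q j : ℝ)) * (cexp (q m * z) - 1 - q m * z) := by
      rw [Finset.prod_range_succ, Finset.sum_range_succ, ofReal_add, mul_add z, Complex.exp_add,
        mul_comm z (q m : ℂ)]
      ring
    have hsmall : ‖(q m : ℂ) * z‖ ≤ 1 := by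
      rw [norm_mul, norm_real, Real.norm_of_nonneg (hq m).1]
      exact mul_le_one₀ (hq m).2 (norm_nonneg _) ht
    rw [e, Finset.sum_range_succ, add_mul]
    refine (norm_sub_le _ _).trans (add_le_add ?_ ?_)
    · rw [norm_mul]
      refine (mul_le_of_le_one_right (norm_nonneg _) (norm_one_add_mul_le (hq m) t)).trans ih
    · rw [norm_mul]
      refine (mul_le_of_le_one_left (norm_nonneg _)
        (norm_exp_mul_le (Finset.sum_nonneg fun j _ => (hq j).1) t)).trans ?_
      refine (norm_exp_sub_one_sub_id_le hsmall).trans_eq ?_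
      rw [norm_mul, mul_pow, norm_real, Real.norm_of_nonneg (hq m).1]

/-- With `s = t / √ℓ` one has `ℓ s ^ 2 = t ^ 2`, so the quadratic Taylor term gives the limit and
the cubic remainder is of order `t ^ 2 |s|`. -/
theorem tendsto_mul_exp_sub (ℓ : ℕ → ℝ) (hℓ : Tendsto ℓ atTop atTop) (t : ℝ) :
    Tendsto (fun n => (ℓ n : ℂ) * (cexp (((√(ℓ n))⁻¹ * t : ℝ) * I) - 1 -
      ((√(ℓ n))⁻¹ * t : ℝ) * I)) atTop (𝓝 (-(t ^ 2) / 2)) := by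
  have hs : Tendsto (fun n => (√(ℓ n))⁻¹ * t) atTop (𝓝 0) := by
    simpa using ((Real.tendsto_sqrt_atTop.comp hℓ).inv_tendsto_atTop).mul_const t
  rw [tendsto_iff_norm_sub_tendsto_zero]
  have hbound : Tendsto (fun n => t ^ 2 * |(√(ℓ n))⁻¹ * t|) atTop (𝓝 0) := by
    simpa using (hs.abs).const_mul (t ^ 2)
  refine squeeze_zero' (Eventually.of_forall fun n => norm_nonneg _) ?_ hbound
  have h1 : ∀ᶠ n in atTop, |(√(ℓ n))⁻¹ * t| < 1 := by
    have := hs.abs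
    rw [abs_zero] at this
    exact this.eventually (gt_mem_nhds one_pos)
  filter_upwards [h1, hℓ.eventually_gt_atTop 0] with n hn hpos
  set s := (√(ℓ n))⁻¹ * t with hsdef
  have hls : ℓ n * s ^ 2 = t ^ 2 := by
    rw [hsdef, mul_pow, inv_pow, Real.sq_sqrt hpos.le]
    field_simp
  have hnorm : ‖(s : ℂ) * I‖ = |s| := by simp
  have hb := exp_bound (x := (s : ℂ) * I) (by rw [hnorm]; exact hn.le) (n := 3) (by norm_num)
  have e : (ℓ n : ℂ) * (cexp (s * I) - 1 - s * I) - -(t : ℂ) ^ 2 / 2 =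
      ℓ n * (cexp (s * I) - ∑ m ∈ Finset.range 3, ((s : ℂ) * I) ^ m / (m.factorial : ℂ)) := by
    have hls' : (ℓ n : ℂ) * (s : ℂ) ^ 2 = (t : ℂ) ^ 2 := by exact_mod_cast hls
    simp only [Finset.sum_range_succ, Finset.sum_range_zero]
    norm_num [Nat.factorial, mul_pow, I_sq]
    linear_combination (1 / 2 : ℂ) * -hls'
  rw [e, norm_mul, norm_real, Real.norm_of_nonneg hpos.le]
  rw [hnorm] at hb
  calc ℓ n * _ ≤ ℓ n * (|s| ^ 3 * 1) := by
        refine mul_le_mul_of_nonneg_left (hb.trans ?_) hpos.le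
        refine mul_le_mul_of_nonneg_left ?_ (by positivity)
        norm_num [Nat.factorial]
    _ = t ^ 2 * |s| := by
        rw [← hls, ← sq_abs s]
        ring

theorem tendsto_charFun_bernoulliSum (hq : ∀ m, q m ∈ Set.Icc (0 : ℝ) 1) {C D : ℝ}
    (hC : ∀ m, ∑ j ∈ Finset.range m, q j ^ 2 ≤ C) {ℓ c : ℕ → ℝ} {N : ℕ → ℕ}
    (hℓ : Tendsto ℓ atTop atTop)
    (hD : ∀ᶠ n in atTop, |∑ j ∈ Finset.range (N n), q j - ℓ n| ≤ D) {a : ℝ}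
    (hc : Tendsto (fun n => (c n - ℓ n) / √(ℓ n)) atTop (𝓝 a)) (t : ℝ) :
    Tendsto (fun n => charFun (((bernoulliSum q (N n)).map (· + -c n)).map ((√(ℓ n))⁻¹ * ·)) t)
      atTop (𝓝 (cexp (t * (-a : ℝ) * I - t ^ 2 / 2))) := by
  have hs : Tendsto (fun n => (√(ℓ n))⁻¹ * t) atTop (𝓝 0) := by
    simpa using ((Real.tendsto_sqrt_atTop.comp hℓ).inv_tendsto_atTop).mul_const t
  set s := fun n => (√(ℓ n))⁻¹ * t with hsdef
  set z := fun n => cexp ((s n : ℝ) * I) - 1 with hzdef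
  have hz : Tendsto z atTop (𝓝 0) := by
    have : Continuous fun x : ℝ => cexp (x * I) - 1 := by fun_prop
    have h := (this.tendsto 0).comp hs
    simp only [ofReal_zero, zero_mul, Complex.exp_zero, sub_self] at h
    exact h
  set b := fun n => ∑ j ∈ Finset.range (N n), q j with hbdef
  -- The exponent is split as `z (b - ℓ) + ℓ (z - i s) - i (c - ℓ) s`: the first term vanishes since
  -- `b - ℓ` is bounded, the second gives the variance and the third the shift by `-a`.
  have hexp : Tendsto (fun n => z n * (b n : ℝ) + ((-c n * s n : ℝ) : ℂ) * I) atTop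
      (𝓝 (t * (-a : ℝ) * I - t ^ 2 / 2)) := by
    have h1 : Tendsto (fun n => z n * ((b n - ℓ n : ℝ) : ℂ)) atTop (𝓝 0) := by
      rw [tendsto_zero_iff_norm_tendsto_zero] at hz ⊢
      refine squeeze_zero' (Eventually.of_forall fun n => norm_nonneg _) ?_
        (by simpa using hz.mul_const D)
      filter_upwards [hD] with n hn
      rw [norm_mul, norm_real]
      exact mul_le_mul_of_nonneg_left hn (norm_nonneg _)
    have h2 := tendsto_mul_exp_sub ℓ hℓ t
    have h3 : Tendsto (fun n => ((((c n - ℓ n) / √(ℓ n) : ℝ) : ℂ)) * (t * I)) atTop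
        (𝓝 ((a : ℂ) * (t * I))) :=
      ((continuous_ofReal.tendsto a).comp hc).mul_const _
    have h4 := (h1.add h2).sub h3
    refine (h4.congr fun n => ?_).trans_eq ?_
    · have : ((((c n - ℓ n) / √(ℓ n) : ℝ) : ℂ)) * (t * I) = ((c n - ℓ n : ℝ) : ℂ) * (s n * I) := by
        simp only [hsdef]
        push_cast
        ring
      rw [this]
      simp only [hzdef, hsdef]
      push_cast
      ring
    · congr 1
      push_cast
      ring
  have hmain := (Complex.continuous_exp.tendsto _).comp hexp
  have hdiff : Tendsto (fun n => (∏ j ∈ Finset.range (N n), (1 + (q j : ℂ) * z n) -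
      cexp (z n * (b n : ℝ))) * cexp (((-c n * s n : ℝ) : ℂ) * I)) atTop (𝓝 0) := by
    rw [tendsto_zero_iff_norm_tendsto_zero] at hz ⊢
    refine squeeze_zero' (Eventually.of_forall fun n => norm_nonneg _) ?_
      (by simpa using (hz.pow 2).const_mul C)
    filter_upwards [hz.eventually (gt_mem_nhds one_pos)] with n hn
    rw [norm_mul, norm_exp_ofReal_mul_I, mul_one]
    refine (norm_prod_sub_exp_le hq hn.le (N n)).trans ?_
    exact mul_le_mul_of_nonneg_right (hC _) (by positivity)
  have := hdiff.add hmain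
  rw [zero_add] at this
  refine this.congr fun n => ?_
  rw [charFun_map_mul, charFun_map_add_const, charFun_bernoulliSum hq]
  simp only [Function.comp_apply, RCLike.inner_apply, conj_trivial, Complex.exp_add]
  simp only [hzdef, hsdef, hbdef]
  rw [mul_comm ((√(ℓ n))⁻¹ * t) (-c n)]
  ring

end Poisson

/-- Centring at `c n` instead of the mean makes the event the fixed set `Iio 0` and the limit law
`N(-a, 1)`, which does not charge the boundary. Lévy's continuity theorem then applies. -/
theorem tendsto_bernoulliSum_Iio {q : ℕ → ℝ} (hq : ∀ m, q m ∈ Set.Icc (0 : ℝ) 1) {C D : ℝ}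
    (hC : ∀ m, ∑ j ∈ Finset.range m, q j ^ 2 ≤ C) {ℓ c : ℕ → ℝ} {N : ℕ → ℕ}
    (hℓ : Tendsto ℓ atTop atTop)
    (hD : ∀ᶠ n in atTop, |∑ j ∈ Finset.range (N n), q j - ℓ n| ≤ D) {a : ℝ}
    (hc : Tendsto (fun n => (c n - ℓ n) / √(ℓ n)) atTop (𝓝 a)) :
    Tendsto (fun n => (bernoulliSum q (N n)).real (Set.Iio (c n))) atTop
      (𝓝 (cdf (gaussianReal 0 1) a)) := by
  have := isProbabilityMeasure_bernoulliSum hq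
  have hP : ∀ n, IsProbabilityMeasure
      (((bernoulliSum q (N n)).map (· + -c n)).map ((√(ℓ n))⁻¹ * ·)) := fun n => by
    have : IsProbabilityMeasure ((bernoulliSum q (N n)).map (· + -c n)) :=
      Measure.isProbabilityMeasure_map (by fun_prop)
    exact Measure.isProbabilityMeasure_map (by fun_prop)
  let ν : ℕ → ProbabilityMeasure ℝ := fun n => ⟨_, hP n⟩
  let ν₀ : ProbabilityMeasure ℝ := ⟨gaussianReal (-a) 1, inferInstance⟩
  have hconv : Tendsto ν atTop (𝓝 ν₀) := by
    refine ProbabilityMeasure.tendsto_iff_tendsto_charFun.2 fun t => ?_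
    change Tendsto _ atTop (𝓝 (charFun (gaussianReal (-a) 1) t))
    rw [charFun_gaussianReal]
    have h := tendsto_charFun_bernoulliSum hq hC hℓ hD hc t
    simp only [NNReal.coe_one, Complex.ofReal_one, one_mul]
    exact h
  have hna : NullSingletonClass (gaussianReal (-a) 1) := nullSingletonClass_gaussianReal one_ne_zero
  have hlim := ProbabilityMeasure.tendsto_measure_of_null_frontier_of_tendsto' hconv
    (E := Set.Iio 0) (by
      rw [frontier_Iio]
      exact measure_singleton (μ := gaussianReal (-a) 1) 0)
  have hval : (gaussianReal (-a) 1).real (Set.Iio 0) = cdf (gaussianReal 0 1) a := by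
    have : NullSingletonClass (gaussianReal 0 1) :=
      nullSingletonClass_gaussianReal one_ne_zero
    rw [cdf_eq_real, measureReal_congr Iio_ae_eq_Iic.symm, ← zero_add (-a),
      ← gaussianReal_map_add_const, map_measureReal_apply (by fun_prop) measurableSet_Iio]
    congr 1
    ext x
    simp
  have hlim' := (ENNReal.tendsto_toReal (by finiteness)).comp hlim
  change Tendsto _ atTop (𝓝 ((gaussianReal (-a) 1).real (Set.Iio 0))) at hlim'
  rw [hval] at hlim'
  refine hlim'.congr' ?_
  filter_upwards [hℓ.eventually_gt_atTop 0] with n hn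
  change (((bernoulliSum q (N n)).map (· + -c n)).map ((√(ℓ n))⁻¹ * ·)).real (Set.Iio 0) = _
  rw [map_measureReal_apply (by fun_prop) measurableSet_Iio, map_measureReal_apply (by fun_prop)
    (measurableSet_Iio.preimage (by fun_prop))]
  congr 1
  ext x
  have : 0 < (√(ℓ n))⁻¹ := by positivity
  simp only [Set.mem_preimage, Set.mem_Iio]
  constructor <;> intro h <;> nlinarith

theorem cdf_gaussianReal_eq (a : ℝ) :
    cdf (gaussianReal 0 1) a =
      1 / √(2 * Real.pi) * ∫ t in Set.Iic a, Real.exp (-t ^ 2 / 2) := by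
  rw [cdf_eq_real, Measure.real, gaussianReal_apply_eq_integral _ one_ne_zero,
    ENNReal.toReal_ofReal (integral_nonneg fun x => gaussianPDFReal_nonneg _ _ _),
    ← integral_const_mul]
  simp [gaussianPDFReal]

/-! ### Chambers as permutations and signed permutations. -/

section Sorting

variable {n : ℕ}

/-- The permutation that sorts a tuple in decreasing order. -/
noncomputable def sortDesc (c : Fin n → ℝ) : Equiv.Perm (Fin n) := Tuple.sort (fun i => -c i)

theorem strictAnti_sortDesc {c : Fin n → ℝ} (hc : Function.Injective c) :
    StrictAnti (c ∘ sortDesc c) := by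
  have h : Monotone ((fun i => -c i) ∘ sortDesc c) := Tuple.monotone_sort _
  have h' : Antitone (c ∘ sortDesc c) := fun i j hij => neg_le_neg_iff.1 (h hij)
  exact h'.strictAnti_of_injective (hc.comp (sortDesc c).injective)

theorem eq_sortDesc {c : Fin n → ℝ} {σ : Equiv.Perm (Fin n)} (h : StrictAnti (c ∘ σ)) :
    σ = sortDesc c := by
  refine Tuple.eq_sort_iff.2 ⟨fun i j hij => neg_le_neg (h.antitone hij), fun i j hij he => ?_⟩
  exact absurd (neg_injective he) (h hij).ne'

theorem injective_of_strictAnti_comp {c : Fin n → ℝ} {σ : Equiv.Perm (Fin n)}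
    (h : StrictAnti (c ∘ σ)) : Function.Injective c := by
  have := h.injective
  rwa [Equiv.injective_comp] at this

theorem sortDesc_eq_iff {c c' : Fin n → ℝ} (hc : Function.Injective c)
    (hc' : Function.Injective c') :
    sortDesc c = sortDesc c' ↔ ∀ i j, c i < c j ↔ c' i < c' j := by
  constructor
  · intro h i j
    have h1 := strictAnti_sortDesc hc
    have h2 := strictAnti_sortDesc hc'
    rw [← h] at h2
    obtain ⟨i, rfl⟩ := (sortDesc c).surjective i
    obtain ⟨j, rfl⟩ := (sortDesc c).surjective j
    exact h1.lt_iff_gt.trans h2.lt_iff_gt.symm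
  · intro h
    refine eq_sortDesc fun i j hij => ?_
    exact (h _ _).1 (strictAnti_sortDesc hc hij)

end Sorting

section TypeA

variable {m : ℕ}

theorem forall_forms_one {P : ((Fin m → ℝ) →ₗ[ℝ] ℝ) → Prop} :
    (∀ w ∈ forms {1} m, P w) ↔ (∀ i, P (LinearMap.proj i)) ∧
      ∀ i j, i < j → P (LinearMap.proj i - (1 : ℝ) • LinearMap.proj j) := by
  constructor
  · intro h
    exact ⟨fun i => h _ (Or.inl ⟨i, rfl⟩), fun i j hij =>
      h _ (Or.inr ⟨i, j, 1, Finset.mem_singleton_self _, hij, rfl⟩)⟩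
  · rintro ⟨h1, h2⟩ w (⟨i, rfl⟩ | ⟨i, j, s, hs, hij, rfl⟩)
    · exact h1 i
    · rw [Finset.mem_singleton] at hs
      subst hs
      exact h2 i j hij

/-- Appending the coordinate `0` turns every form into a difference of two coordinates: this is the
braid arrangement on `m + 1` coordinates, normalised by a vanishing last one. -/
theorem mem_regularPoints_one {L : Submodule ℝ (Fin m → ℝ)} {y : Fin m → ℝ} :
    y ∈ regularPoints L (forms {1} m) ↔
      y ∈ L ∧ Function.Injective (Fin.snoc y 0 : Fin (m + 1) → ℝ) := by
  refine and_congr_right fun _ => ?_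
  rw [forall_forms_one]
  simp only [LinearMap.proj_apply, LinearMap.sub_apply, one_smul, sub_ne_zero]
  rw [Fin.snoc_injective_iff]
  constructor
  · rintro ⟨h1, h2⟩
    refine ⟨fun i j hij => ?_, fun ⟨i, hi⟩ => h1 i hi⟩
    rcases lt_trichotomy i j with h | h | h
    · exact absurd hij (h2 i j h)
    · exact h
    · exact absurd hij.symm (h2 j i h)
  · rintro ⟨h1, h2⟩
    exact ⟨fun i hi => h2 ⟨i, hi⟩, fun i j hij he => hij.ne (h1 he)⟩

theorem posForms_one_eq_iff {L : Submodule ℝ (Fin m → ℝ)} {p q : Fin m → ℝ}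
    (hp : p ∈ regularPoints L (forms {1} m)) (hq : q ∈ regularPoints L (forms {1} m)) :
    posForms (forms {1} m) p = posForms (forms {1} m) q ↔
      ∀ i j, (Fin.snoc p 0 : Fin (m + 1) → ℝ) i < (Fin.snoc p 0 : Fin (m + 1) → ℝ) j ↔
        (Fin.snoc q 0 : Fin (m + 1) → ℝ) i < (Fin.snoc q 0 : Fin (m + 1) → ℝ) j := by
  have hp2 := hp.2
  have hq2 := hq.2
  rw [forall_forms_one] at hp2 hq2
  rw [posForms_eq_iff, forall_forms_one]
  simp only [LinearMap.proj_apply, LinearMap.sub_apply, one_smul, sub_ne_zero, sub_pos]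
    at hp2 hq2 ⊢
  constructor
  · rintro ⟨h1, h2⟩ i j
    induction i using Fin.lastCases with
    | last =>
      induction j using Fin.lastCases with
      | last => simp
      | cast j => simpa using h1 j
    | cast i =>
      induction j using Fin.lastCases with
      | last =>
        simp only [Fin.snoc_castSucc, Fin.snoc_last]
        have := h1 i; have := hp2.1 i; have := hq2.1 i
        grind
      | cast j =>
        simp only [Fin.snoc_castSucc]
        rcases lt_trichotomy i j with h | rfl | h
        · have := h2 i j h; have := hp2.2 i j h; have := hq2.2 i j h
          grind
        · simp
        · exact h2 j i h
  · intro h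
    exact ⟨fun i => by simpa using h (Fin.last m) i.castSucc,
      fun i j _ => by simpa using h j.castSucc i.castSucc⟩

theorem ncard_perm_chambers (L : Submodule ℝ (Fin m → ℝ)) :
    {σ : Equiv.Perm (Fin (m + 1)) |
      ∃ y ∈ L, StrictAnti ((Fin.snoc y 0 : Fin (m + 1) → ℝ) ∘ σ)}.ncard =
      numRegions L (forms {1} m) := by
  have h : {σ : Equiv.Perm (Fin (m + 1)) |
      ∃ y ∈ L, StrictAnti ((Fin.snoc y 0 : Fin (m + 1) → ℝ) ∘ σ)} =
      (fun y => sortDesc (Fin.snoc y 0 : Fin (m + 1) → ℝ)) '' regularPoints L (forms {1} m) := by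
    ext σ
    constructor
    · rintro ⟨y, hy, hσ⟩
      exact ⟨y, mem_regularPoints_one.2 ⟨hy, injective_of_strictAnti_comp hσ⟩,
        (eq_sortDesc hσ).symm⟩
    · rintro ⟨y, hy, rfl⟩
      rw [mem_regularPoints_one] at hy
      exact ⟨y, hy.1, strictAnti_sortDesc hy.2⟩
  rw [h, numRegions]
  refine ncard_image_eq_of_eq_iff fun p hp q hq => ?_
  rw [posForms_one_eq_iff hp hq, sortDesc_eq_iff (mem_regularPoints_one.1 hp).2
    (mem_regularPoints_one.1 hq).2]

end TypeA

section TypeB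

variable {m : ℕ}

theorem forall_forms_pm {P : ((Fin m → ℝ) →ₗ[ℝ] ℝ) → Prop} :
    (∀ w ∈ forms {1, -1} m, P w) ↔ (∀ i, P (LinearMap.proj i)) ∧
      ∀ i j, i < j → P (LinearMap.proj i - (1 : ℝ) • LinearMap.proj j) ∧
        P (LinearMap.proj i - (-1 : ℝ) • LinearMap.proj j) := by
  constructor
  · intro h
    exact ⟨fun i => h _ (Or.inl ⟨i, rfl⟩), fun i j hij =>
      ⟨h _ (Or.inr ⟨i, j, 1, by simp, hij, rfl⟩), h _ (Or.inr ⟨i, j, -1, by simp, hij, rfl⟩)⟩⟩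
  · rintro ⟨h1, h2⟩ w (⟨i, rfl⟩ | ⟨i, j, s, hs, hij, rfl⟩)
    · exact h1 i
    · rw [Finset.mem_insert, Finset.mem_singleton] at hs
      rcases hs with rfl | rfl
      exacts [(h2 i j hij).1, (h2 i j hij).2]

theorem mem_regularPoints_pm {L : Submodule ℝ (Fin m → ℝ)} {y : Fin m → ℝ} :
    y ∈ regularPoints L (forms {1, -1} m) ↔
      y ∈ L ∧ (∀ i, y i ≠ 0) ∧ Function.Injective (fun i => |y i|) := by
  refine and_congr_right fun _ => ?_
  rw [forall_forms_pm]
  simp only [LinearMap.proj_apply, LinearMap.sub_apply, LinearMap.smul_apply, smul_eq_mul, one_mul,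
    neg_mul, sub_neg_eq_add]
  refine and_congr_right fun _ => ?_
  constructor
  · intro h2 i j hij
    have hij : |y i| = |y j| := hij
    rw [abs_eq_abs] at hij
    rcases lt_trichotomy i j with h | h | h
    · have := h2 i j h
      grind
    · exact h
    · have := h2 j i h
      grind
  · intro h i j hij
    have h1 : |y i| ≠ |y j| := fun he => hij.ne (h he)
    rw [Ne, abs_eq_abs, not_or] at h1
    exact ⟨sub_ne_zero.2 h1.1, fun h2 => h1.2 (eq_neg_of_add_eq_zero_left h2)⟩

/-- Once the signs of `a` and `b` are known, one of `a - b`, `a + b` has a forced sign, and the sign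
of the other decides which absolute value is larger. -/
theorem sign_pattern_iff {a b a' b' : ℝ} (ha : a ≠ 0) (hb : b ≠ 0) (ha' : a' ≠ 0) (hb' : b' ≠ 0)
    (h : |a| ≠ |b|) (h' : |a'| ≠ |b'|) (hsa : 0 < a ↔ 0 < a') (hsb : 0 < b ↔ 0 < b') :
    ((0 < a - b ↔ 0 < a' - b') ∧ (0 < a + b ↔ 0 < a' + b')) ↔ (|a| < |b| ↔ |a'| < |b'|) := by
  rcases lt_or_gt_of_ne ha with h1 | h1 <;> rcases lt_or_gt_of_ne hb with h2 | h2 <;>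
  rcases lt_or_gt_of_ne ha' with h3 | h3 <;> rcases lt_or_gt_of_ne hb' with h4 | h4 <;>
  simp only [abs_of_neg, abs_of_pos, h1, h2, h3, h4] at h h' ⊢ <;>
  grind

theorem posForms_pm_eq_iff {L : Submodule ℝ (Fin m → ℝ)} {p q : Fin m → ℝ}
    (hp : p ∈ regularPoints L (forms {1, -1} m)) (hq : q ∈ regularPoints L (forms {1, -1} m)) :
    posForms (forms {1, -1} m) p = posForms (forms {1, -1} m) q ↔
      (∀ i, 0 < p i ↔ 0 < q i) ∧ ∀ i j, |p i| < |p j| ↔ |q i| < |q j| := by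
  obtain ⟨_, hp0, hpi⟩ := mem_regularPoints_pm.1 hp
  obtain ⟨_, hq0, hqi⟩ := mem_regularPoints_pm.1 hq
  rw [posForms_eq_iff, forall_forms_pm]
  simp only [LinearMap.proj_apply, LinearMap.sub_apply, LinearMap.smul_apply, smul_eq_mul, one_mul,
    neg_mul, sub_neg_eq_add]
  refine and_congr_right fun h => ?_
  have key : ∀ i j, i ≠ j → (((0 < p i - p j ↔ 0 < q i - q j) ∧ (0 < p i + p j ↔ 0 < q i + q j)) ↔
      (|p i| < |p j| ↔ |q i| < |q j|)) := fun i j hij =>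
    sign_pattern_iff (hp0 i) (hp0 j) (hq0 i) (hq0 j) (hpi.ne hij) (hqi.ne hij) (h i) (h j)
  constructor
  · intro h2 i j
    rcases lt_trichotomy i j with hij | rfl | hij
    · exact (key i j hij.ne).1 (h2 i j hij)
    · simp
    · have h3 := (key j i hij.ne).1 (h2 j i hij)
      have h4 := hpi.ne hij.ne
      have h5 := hqi.ne hij.ne
      grind
  · intro h2 i j hij
    exact (key i j hij.ne).2 (h2 i j)

theorem units_smul_real (u : ℤˣ) (x : ℝ) : u • x = x ∧ u = 1 ∨ u • x = -x ∧ u = -1 := by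
  rcases Int.units_eq_one_or u with rfl | rfl
  · exact Or.inl ⟨one_smul _ _, rfl⟩
  · exact Or.inr ⟨by simp [Units.smul_def], rfl⟩

open Classical in
/-- The signed permutation that makes a tuple positive and decreasing. -/
noncomputable def signSort (y : Fin m → ℝ) : Equiv.Perm (Fin m) × (Fin m → ℤˣ) :=
  (sortDesc (fun i => |y i|), fun i => if 0 < y (sortDesc (fun i => |y i|) i) then 1 else -1)

/-- The tuple `y` lies in the open Weyl chamber of type `B` given by the signed permutation `g`. -/
def InChamber (g : Equiv.Perm (Fin m) × (Fin m → ℤˣ)) (y : Fin m → ℝ) : Prop :=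
  StrictAnti (fun i => g.2 i • y (g.1 i)) ∧ ∀ i, 0 < g.2 i • y (g.1 i)

theorem InChamber.abs_eq {g : Equiv.Perm (Fin m) × (Fin m → ℤˣ)} {y : Fin m → ℝ}
    (h : InChamber g y) : (fun i => |y i|) ∘ g.1 = fun i => g.2 i • y (g.1 i) := by
  funext i
  have h1 := h.2 i
  rcases units_smul_real (g.2 i) (y (g.1 i)) with ⟨h2, _⟩ | ⟨h2, _⟩
  · rw [h2] at h1 ⊢
    exact abs_of_pos h1
  · rw [h2] at h1 ⊢
    exact abs_of_neg (neg_pos.1 h1)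

theorem InChamber.strictAnti_abs {g : Equiv.Perm (Fin m) × (Fin m → ℤˣ)} {y : Fin m → ℝ}
    (h : InChamber g y) : StrictAnti ((fun i => |y i|) ∘ g.1) := by
  rw [h.abs_eq]
  exact h.1

theorem InChamber.ne_zero {g : Equiv.Perm (Fin m) × (Fin m → ℤˣ)} {y : Fin m → ℝ}
    (h : InChamber g y) (i : Fin m) : y i ≠ 0 := by
  intro h0
  have := h.2 (g.1.symm i)
  simp [h0] at this

theorem InChamber.eq_signSort {g : Equiv.Perm (Fin m) × (Fin m → ℤˣ)} {y : Fin m → ℝ}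
    (h : InChamber g y) : g = signSort y := by
  have h1 := eq_sortDesc h.strictAnti_abs
  refine Prod.ext h1 (funext fun i => ?_)
  have h2 := h.2 i
  simp only [signSort]
  rw [← h1]
  rcases units_smul_real (g.2 i) (y (g.1 i)) with ⟨h3, h4⟩ | ⟨h3, h4⟩
  · rw [h3] at h2
    rw [if_pos h2, h4]
  · rw [h3] at h2
    rw [if_neg (by linarith), h4]

theorem inChamber_signSort {y : Fin m → ℝ} (h0 : ∀ i, y i ≠ 0)
    (hi : Function.Injective (fun i => |y i|)) : InChamber (signSort y) y := by
  have e : (fun i => (signSort y).2 i • y ((signSort y).1 i)) =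
      (fun i => |y i|) ∘ sortDesc (fun i => |y i|) := by
    funext i
    simp only [signSort, Function.comp]
    split_ifs with h
    · rw [one_smul, abs_of_pos h]
    · rw [abs_of_nonpos (not_lt.1 h)]
      simp [Units.smul_def]
  refine ⟨?_, fun i => ?_⟩
  · rw [e]
    exact strictAnti_sortDesc hi
  · rw [congrFun e i]
    exact abs_pos.2 (h0 _)

theorem signSort_eq_iff {p q : Fin m → ℝ} (hpi : Function.Injective (fun i => |p i|))
    (hqi : Function.Injective (fun i => |q i|)) :
    signSort p = signSort q ↔
      (∀ i, 0 < p i ↔ 0 < q i) ∧ ∀ i j, |p i| < |p j| ↔ |q i| < |q j| := by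
  rw [← sortDesc_eq_iff hpi hqi, Prod.ext_iff]
  simp only [signSort]
  rw [and_comm (a := ∀ i, 0 < p i ↔ 0 < q i)]
  refine and_congr_right fun h => ?_
  rw [← h, funext_iff]
  constructor
  · intro h1 i
    obtain ⟨i, rfl⟩ := (sortDesc fun i => |p i|).surjective i
    have := h1 i
    split_ifs at this with h2 h3 h3
    · exact iff_of_true h2 h3
    · exact absurd this (by decide)
    · exact absurd this (by decide)
    · exact iff_of_false h2 h3
  · intro h1 i
    simp only [h1]

theorem ncard_signed_chambers (L : Submodule ℝ (Fin m → ℝ)) :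
    {g : Equiv.Perm (Fin m) × (Fin m → ℤˣ) | ∃ y ∈ L, InChamber g y}.ncard =
      numRegions L (forms {1, -1} m) := by
  have h : {g : Equiv.Perm (Fin m) × (Fin m → ℤˣ) | ∃ y ∈ L, InChamber g y} =
      signSort '' regularPoints L (forms {1, -1} m) := by
    ext g
    constructor
    · rintro ⟨y, hy, hg⟩
      exact ⟨y, mem_regularPoints_pm.2 ⟨hy, hg.ne_zero,
        injective_of_strictAnti_comp hg.strictAnti_abs⟩, hg.eq_signSort.symm⟩
    · rintro ⟨y, hy, rfl⟩
      rw [mem_regularPoints_pm] at hy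
      exact ⟨y, hy.1, inChamber_signSort hy.2.1 hy.2.2⟩
  rw [h, numRegions]
  refine ncard_image_eq_of_eq_iff fun p hp q hq => ?_
  obtain ⟨_, _, hpi⟩ := mem_regularPoints_pm.1 hp
  obtain ⟨_, _, hqi⟩ := mem_regularPoints_pm.1 hq
  rw [posForms_pm_eq_iff hp hq, signSort_eq_iff hpi hqi]

end TypeB

/-! ### Positive relations between vectors in general position. -/

section Positive

variable {E ι : Type*} [AddCommGroup E] [Module ℝ E] [Fintype ι]

/-- Any `d` vectors of the family `v` are linearly independent. -/
def AnyIndep (d : ℕ) (v : ι → E) : Prop :=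
  ∀ I : Finset ι, I.card = d → LinearIndependent ℝ (fun k : I => v k)

theorem AnyIndep.eq_zero {d : ℕ} {v : ι → E} (hv : AnyIndep d v) (hd : d ≤ Fintype.card ι)
    {c : ι → ℝ} {K : Finset ι} (hK : K.card ≤ d) (hc : ∀ i, i ∉ K → c i = 0)
    (h : ∑ i, c i • v i = 0) (i : ι) : c i = 0 := by
  obtain ⟨I, hKI, hI⟩ := Finset.exists_superset_card_eq hK hd
  by_cases hi : i ∈ I
  · have h1 : ∑ k : I, c k • v k = 0 := by
      rw [Finset.sum_coe_sort I (fun k => c k • v k), ← h]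
      refine Finset.sum_subset (Finset.subset_univ _) fun k _ hk => ?_
      rw [hc k fun hk' => hk (hKI hk'), zero_smul]
    exact Fintype.linearIndependent_iff.1 (hv I hI) (fun k => c k) h1 ⟨i, hi⟩
  · exact hc i fun hi' => hi (hKI hi')

/-- A nontrivial relation with nonnegative coefficients can be made strictly positive. -/
theorem AnyIndep.exists_pos [FiniteDimensional ℝ E] {v : ι → E}
    (hv : AnyIndep (Module.finrank ℝ E) v) (hd : Module.finrank ℝ E ≤ Fintype.card ι)
    {c : ι → ℝ} (hc : ∀ i, 0 ≤ c i) (hne : ∃ i, c i ≠ 0) (h : ∑ i, c i • v i = 0) :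
    ∃ c' : ι → ℝ, (∀ i, 0 < c' i) ∧ ∑ i, c' i • v i = 0 := by
  classical
  set K := Finset.univ.filter fun i => c i ≠ 0 with hKdef
  have hK : Module.finrank ℝ E ≤ K.card := by
    by_contra! hlt
    obtain ⟨i, hi⟩ := hne
    exact hi (hv.eq_zero hd (K := K) hlt.le (fun i hi => by simpa [hKdef] using hi) h i)
  -- General position forces the support to have at least `finrank` elements, so some vectors within
  -- it form a basis, in which `∑ v i` can be expanded.
  obtain ⟨I, hIK, hI⟩ := Finset.exists_subset_card_eq hK
  have hspan := (hv I hI).span_eq_top_of_card_eq_finrank' (by simpa using hI)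
  have hmem : ∑ i, v i ∈ Submodule.span ℝ (Set.range fun k : I => v k) := by
    rw [hspan]; exact Submodule.mem_top
  obtain ⟨b, hb⟩ := (Submodule.mem_span_range_iff_exists_fun ℝ).1 hmem
  set b' : ι → ℝ := fun i => if h : i ∈ I then b ⟨i, h⟩ else 0 with hb'
  have hbsum : ∑ i, b' i • v i = ∑ i, v i := by
    rw [← hb]
    have e : ∀ k : I, b k • v k = b' k • v k := fun k => by simp [hb']
    rw [Finset.sum_congr rfl fun k _ => e k, Finset.sum_coe_sort I (fun k => b' k • v k)]
    refine (Finset.sum_subset (Finset.subset_univ _) fun k _ hk => ?_).symm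
    simp [hb', hk]
  have hev : ∀ᶠ ε in 𝓝[>] (0 : ℝ), ∀ i ∈ I, ε * b' i < c i := by
    rw [Filter.eventually_all_finset]
    intro i hi
    have hci : 0 < c i := lt_of_le_of_ne (hc i) (Ne.symm (by simpa [hKdef] using hIK hi))
    have ht : Tendsto (fun ε : ℝ => ε * b' i) (𝓝[>] 0) (𝓝 0) := by
      have : Continuous fun ε : ℝ => ε * b' i := by fun_prop
      simpa using (this.tendsto 0).mono_left nhdsWithin_le_nhds
    exact ht.eventually (gt_mem_nhds hci)
  obtain ⟨ε, hε, hpos⟩ := (hev.and self_mem_nhdsWithin).exists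
  have hpos : 0 < ε := hpos
  -- A multiple of the relation `∑ (1 - b' i) v i = 0` is added. It raises the coefficients off `I`
  -- by `ε`, and for small `ε` those on `I`, positive from the start, stay positive.
  refine ⟨fun i => c i + ε * (1 - b' i), fun i => ?_, ?_⟩
  · by_cases hi : i ∈ I
    · have := hε i hi
      linarith
    · have : b' i = 0 := by simp [hb', hi]
      simp only [this]
      linarith [hc i]
  · simp only [add_smul, mul_smul, sub_smul, one_smul, Finset.sum_add_distrib, h,
      ← Finset.smul_sum, Finset.sum_sub_distrib, hbsum]
    simp

theorem convexHull_range_eq_image_stdSimplex (v : ι → E) :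
    convexHull ℝ (Set.range v) = (fun c : ι → ℝ => ∑ i, c i • v i) '' stdSimplex ℝ ι := by
  classical
  have h : Set.range v = Fintype.linearCombination ℝ v ''
      Set.range (fun i j : ι => if i = j then (1 : ℝ) else 0) := by
    rw [← Set.range_comp]
    congr 1
    funext i
    simp [Fintype.linearCombination_apply]
  rw [h, ← LinearMap.image_convexHull, convexHull_basis_eq_stdSimplex]
  rfl

theorem zero_mem_convexHull_range_iff {v : ι → E} :
    (0 : E) ∈ convexHull ℝ (Set.range v) ↔
      ∃ c : ι → ℝ, (∀ i, 0 ≤ c i) ∧ (∃ i, c i ≠ 0) ∧ ∑ i, c i • v i = 0 := by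
  rw [convexHull_range_eq_image_stdSimplex]
  constructor
  · rintro ⟨c, ⟨hc, hc1⟩, h⟩
    refine ⟨c, hc, ?_, h⟩
    by_contra! h0
    simp [h0] at hc1
  · rintro ⟨c, hc, ⟨i, hi⟩, h⟩
    have hs : 0 < ∑ i, c i :=
      Finset.sum_pos' (fun i _ => hc i) ⟨i, Finset.mem_univ _, lt_of_le_of_ne (hc i) hi.symm⟩
    refine ⟨fun i => (∑ i, c i)⁻¹ * c i, ⟨fun i => mul_nonneg (by positivity) (hc i), ?_⟩, ?_⟩
    · rw [← Finset.mul_sum, inv_mul_cancel₀ hs.ne']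
    · simp only [mul_smul, ← Finset.smul_sum, h, smul_zero]

end Positive

/-! ### Abel summation between increments and partial sums. -/

section Abel

variable {E : Type*} [AddCommGroup E] {n m d : ℕ}

theorem partialSum_zero (x : Fin n → E) : partialSum x 0 = 0 := by
  simp [partialSum]

theorem partialSum_succ (x : Fin n → E) {k : ℕ} (hk : k < n) :
    partialSum x (k + 1) = partialSum x k + x ⟨k, hk⟩ := by
  have : (Finset.univ.filter fun i : Fin n => (i : ℕ) < k + 1) =
      insert ⟨k, hk⟩ (Finset.univ.filter fun i : Fin n => (i : ℕ) < k) := by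
    ext i
    simp only [Finset.mem_filter, Finset.mem_univ, true_and, Finset.mem_insert, Fin.ext_iff]
    omega
  rw [partialSum, partialSum, this, Finset.sum_insert (by simp), add_comm]

theorem partialSum_self (x : Fin n → E) : partialSum x n = ∑ i, x i := by
  simp [partialSum]

theorem image_partialSum_Icc (x : Fin n → E) (m : ℕ) :
    partialSum x '' Set.Icc 1 m = Set.range (fun k : Fin m => partialSum x (k + 1)) := by
  ext y
  constructor
  · rintro ⟨k, ⟨h1, h2⟩, rfl⟩
    exact ⟨⟨k - 1, by omega⟩, by simp only; congr 1; omega⟩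
  · rintro ⟨k, rfl⟩
    exact ⟨k + 1, ⟨by omega, by omega⟩, rfl⟩

variable [Module ℝ E]

theorem sum_sub_smul_partialSum (x : Fin n → E) (c : ℕ → ℝ) (N : ℕ) (hN : N ≤ n) :
    ∑ k ∈ Finset.range N, (c k - c (k + 1)) • partialSum x (k + 1) + c N • partialSum x N =
      ∑ i : Fin N, c i • x (Fin.castLE hN i) := by
  induction N with
  | zero => simp [partialSum_zero]
  | succ N ih =>
    have h := ih (by omega)
    rw [Finset.sum_range_succ, Fin.sum_univ_castSucc]
    simp only [Fin.val_castSucc, Fin.castLE_castSucc, Fin.val_last]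
    rw [← h, partialSum_succ x (show N < n by omega)]
    have e : Fin.castLE hN (Fin.last N) = ⟨N, by omega⟩ := rfl
    rw [e]
    module

/-- Strictly positive relations between partial sums correspond to strictly decreasing positive
relations between the increments. -/
theorem exists_pos_partialSum_iff (x : Fin n → E) (hm : m ≤ n) :
    (∃ c : Fin m → ℝ, (∀ k, 0 < c k) ∧ ∑ k, c k • partialSum x (k + 1) = 0) ↔
      ∃ c : Fin m → ℝ, StrictAnti c ∧ (∀ i, 0 < c i) ∧ ∑ i, c i • x (Fin.castLE hm i) = 0 := by
  constructor
  · rintro ⟨b, hb, h⟩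
    set b' : ℕ → ℝ := fun k => if hk : k < m then b ⟨k, hk⟩ else 0 with hb'
    -- Tail sums invert the passage to consecutive differences.
    set c : ℕ → ℝ := fun j => ∑ k ∈ Finset.Ico j m, b' k with hc
    have hsub : ∀ k < m, c k = b' k + c (k + 1) := fun k hk => by
      simp only [hc]
      rw [Finset.sum_eq_sum_Ico_succ_bot hk]
    have hcm : c m = 0 := by simp [hc]
    have hpos : ∀ k < m, 0 < b' k := fun k hk => by simp only [hb', hk, dif_pos]; exact hb _
    refine ⟨fun i => c i, fun i j hij => ?_, fun i => ?_, ?_⟩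
    · simp only [hc]
      refine Finset.sum_lt_sum_of_subset (i := (i : ℕ))
        (Finset.Ico_subset_Ico_left (le_of_lt hij)) (by simp) (by simp [hij])
        (hpos i i.2) fun k hk _ => (hpos k (Finset.mem_Ico.1 hk).2).le
    · exact Finset.sum_pos (fun k hk => hpos k (Finset.mem_Ico.1 hk).2) ⟨i, by simp⟩
    · rw [← sum_sub_smul_partialSum x c m hm, hcm, zero_smul, add_zero, ← h, Finset.sum_range]
      refine Finset.sum_congr rfl fun k _ => ?_
      rw [hsub k k.2]
      simp [hb']
  · rintro ⟨c, hanti, hpos, h⟩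
    -- The value `0` at index `m` makes the last difference equal to the last coefficient, so
    -- positivity of `c` is used there and monotonicity elsewhere.
    set c' : ℕ → ℝ := fun k => if hk : k < m then c ⟨k, hk⟩ else 0 with hc'
    refine ⟨fun k => c' k - c' (k + 1), fun k => ?_, ?_⟩
    · simp only [hc', k.2, dif_pos]
      split_ifs with hk
      · exact sub_pos.2 (hanti (Fin.lt_def.2 (Nat.lt_succ_self _)))
      · simpa using hpos k
    · have := sum_sub_smul_partialSum x c' m hm
      rw [Finset.sum_range] at this
      have hcm : c' m = 0 := by simp [hc']
      rw [hcm, zero_smul, add_zero] at this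
      rw [this, ← h]
      exact Finset.sum_congr rfl fun i _ => by simp [hc']

/-- The partial sums `S_1, ..., S_m` are in general position. -/
def SumsIndep (d m : ℕ) (x : Fin n → E) : Prop :=
  ∀ I : Finset ℕ, I ⊆ Finset.Icc 1 m → I.card = d →
    LinearIndependent ℝ (fun k : I => partialSum x (k : ℕ))

theorem SumsIndep.anyIndep {x : Fin n → E} (h : SumsIndep d m x) :
    AnyIndep d (fun k : Fin m => partialSum x (k + 1)) := by
  intro I hI
  have hinj : Function.Injective fun k : Fin m => (k : ℕ) + 1 := fun i j hij => by
    simpa [Fin.ext_iff] using hij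
  have h1 := h (I.map ⟨_, hinj⟩) (fun k hk => by
    obtain ⟨i, _, rfl⟩ := Finset.mem_map.1 hk
    simp only [Function.Embedding.coeFn_mk, Finset.mem_Icc]
    omega) (by simpa using hI)
  refine h1.comp (fun k : I => ⟨(k : ℕ) + 1, Finset.mem_map.2 ⟨k, k.2, rfl⟩⟩) fun i j hij => ?_
  exact Subtype.ext (Fin.ext (Nat.succ_injective (congrArg Subtype.val hij)))

/-- In general position, the hull of `S_1, ..., S_m` contains the origin if and only if there is a
strictly decreasing positive relation between the increments. -/
theorem SumsIndep.zero_mem_iff [FiniteDimensional ℝ E] {x : Fin n → E}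
    (h : SumsIndep (Module.finrank ℝ E) m x) (hd : Module.finrank ℝ E ≤ m) (hm : m ≤ n)
    (hm0 : 0 < m) :
    (0 : E) ∈ convexHull ℝ (partialSum x '' Set.Icc 1 m) ↔
      ∃ c : Fin m → ℝ, StrictAnti c ∧ (∀ i, 0 < c i) ∧ ∑ i, c i • x (Fin.castLE hm i) = 0 := by
  rw [← exists_pos_partialSum_iff, image_partialSum_Icc, zero_mem_convexHull_range_iff]
  constructor
  · rintro ⟨c, hc, hne, h0⟩
    exact h.anyIndep.exists_pos (by simpa using hd) hc hne h0
  · rintro ⟨c, hc, h0⟩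
    exact ⟨c, fun i => (hc i).le, ⟨⟨0, hm0⟩, (hc _).ne'⟩, h0⟩

/-- In general position there is no nontrivial relation between the increments whose coefficients
are constant on `d` consecutive blocks and vanish afterwards. -/
theorem SumsIndep.block_eq_zero {x : Fin n → E} (h : SumsIndep d m x) (hd : d ≤ m) (hm : m ≤ n)
    {κ : Fin n → ℕ} (hκ : Monotone κ) (hκm : ∀ i : Fin n, m ≤ i → d ≤ κ i) {t : ℕ → ℝ}
    (ht : ∀ a, d ≤ a → t a = 0) (h0 : ∑ i, t (κ i) • x i = 0) (i : Fin n) : t (κ i) = 0 := by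
  classical
  set c : ℕ → ℝ := fun j => if hj : j < n then t (κ ⟨j, hj⟩) else 0 with hc
  have hcge : ∀ j, m ≤ j → c j = 0 := fun j hj => by
    simp only [hc]
    split_ifs with h'
    · exact ht _ (hκm _ hj)
    · rfl
  have hcfin : ∀ i : Fin n, c i = t (κ i) := fun i => by simp [hc]
  have hrel : ∑ k : Fin m, (c k - c (k + 1)) • partialSum x (k + 1) = 0 := by
    have h1 := sum_sub_smul_partialSum x c n le_rfl
    rw [hcge n hm, zero_smul, add_zero] at h1
    have h2 : ∑ i : Fin n, c i • x (Fin.castLE le_rfl i) = 0 := by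
      rw [← h0]
      exact Finset.sum_congr rfl fun i _ => by rw [hcfin]; rfl
    rw [h2] at h1
    rw [← Finset.sum_range (fun k => (c k - c (k + 1)) • partialSum x (k + 1)), ← h1]
    refine Finset.sum_subset (Finset.range_mono hm) fun k _ hk => ?_
    have hk : m ≤ k := by simpa using hk
    rw [hcge k hk, hcge (k + 1) (by omega), sub_zero, zero_smul]
  -- Coefficients jump only at the end of a block, so at most one nonzero difference belongs to each
  -- of the `d` blocks.
  have hcard : (Finset.univ.filter fun k : Fin m => c k - c (k + 1) ≠ 0).card ≤ d := by
    rw [← Finset.card_range d]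
    refine Finset.card_le_card_of_injOn (fun k => κ (Fin.castLE hm k)) ?_ ?_
    · intro k hk
      have hk : c k - c (k + 1) ≠ 0 := by simpa using hk
      simp only [Finset.coe_range, Set.mem_Iio]
      by_contra! hge
      refine hk ?_
      have h1 : c k = 0 := by rw [← Fin.val_castLE hm k, hcfin]; exact ht _ hge
      have h2 : c (k + 1) = 0 := by
        by_cases hkn : (k : ℕ) + 1 < n
        · have : c ((⟨k + 1, hkn⟩ : Fin n) : ℕ) = 0 := by
            rw [hcfin]
            exact ht _ (hge.trans (hκ (Fin.le_def.2 (by simp))))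
          exact this
        · simp [hc, hkn]
      rw [h1, h2, sub_zero]
    · have key : ∀ k k' : Fin m, c k - c (k + 1) ≠ 0 →
          κ (Fin.castLE hm k) = κ (Fin.castLE hm k') → ¬ k < k' := by
        intro k k' hk he hlt
        have hkn : (k : ℕ) + 1 < n := by
          have := Fin.lt_def.1 hlt
          omega
        refine hk (sub_eq_zero.2 ?_)
        have h1 : κ ⟨k + 1, hkn⟩ = κ (Fin.castLE hm k) := by
          refine le_antisymm ?_ (hκ (Fin.le_def.2 (by simp)))
          rw [he]
          exact hκ (Fin.le_def.2 (by simpa using hlt))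
        have h2 : c ((⟨k + 1, hkn⟩ : Fin n) : ℕ) = c k := by
          rw [hcfin, h1, ← hcfin]
          rfl
        exact h2.symm
      intro k hk k' hk' he
      have hk : c k - c (k + 1) ≠ 0 := by simpa using hk
      have hk' : c k' - c (k' + 1) ≠ 0 := by simpa using hk'
      exact le_antisymm (not_lt.1 (key k' k hk' he.symm)) (not_lt.1 (key k k' hk he))
  have hzero := h.anyIndep.eq_zero (by simpa using hd) hcard (fun i hi => by simpa using hi) hrel
  -- All differences vanish and `c m = 0`, so the coefficients vanish by descent from `m`.
  have hall : ∀ j, j ≤ m → c (m - j) = 0 := by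
    intro j
    induction j with
    | zero => intro _; exact hcge m le_rfl
    | succ j ih =>
      intro hj
      have h1 := hzero ⟨m - (j + 1), by omega⟩
      have e : m - (j + 1) + 1 = m - j := by omega
      simp only [e] at h1
      rw [ih (by omega), sub_zero] at h1
      exact h1
  rw [← hcfin]
  rcases le_or_gt m i with hi | hi
  · exact hcge i hi
  · have := hall (m - i) (by omega)
    rwa [show m - (m - (i : ℕ)) = i by omega] at this

end Abel

/-! ### Counting the absorbing permutations of a fixed tuple. -/

section Counting

variable {E : Type*} [AddCommGroup E] [Module ℝ E] {n m d : ℕ}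

/-- The space of linear relations between the vectors of a tuple. -/
noncomputable def relations (x : Fin n → E) : Submodule ℝ (Fin n → ℝ) :=
  LinearMap.ker (Fintype.linearCombination ℝ x)

theorem mem_relations {x : Fin n → E} {y : Fin n → ℝ} :
    y ∈ relations x ↔ ∑ i, y i • x i = 0 := by
  rw [relations, LinearMap.mem_ker, Fintype.linearCombination_apply]

theorem smul_units_smul (c : ℝ) (u : ℤˣ) (v : E) : c • u • v = (u • c) • v := by
  rcases Int.units_eq_one_or u with rfl | rfl <;> simp [Units.smul_def]

theorem units_smul_units_smul {M : Type*} [AddCommGroup M] (u : ℤˣ) (v : M) : u • u • v = v := by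
  rcases Int.units_eq_one_or u with rfl | rfl <;> simp [Units.smul_def]

/-- The parameters of a flat and the ambient space both have dimension `d`, so injectivity of `t ↦ ∑
flatPoint f ε t i • x i` already gives surjectivity, the spanning half of genericity. -/
theorem isGeneric_relations [FiniteDimensional ℝ E] {S : Finset ℝ} {x : Fin n → E}
    (hd : Module.finrank ℝ E = d)
    (h : ∀ (f : Fin n → Option (Fin d)) (ε : Fin n → ℝ), (∀ i, ε i ∈ S) →
      (∀ a, ∃ i, f i = some a) → ∀ t, ∑ i, flatPoint f ε t i • x i = 0 → t = 0) :
    IsGeneric S d (relations x) := by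
  intro f ε hε hf
  have h1 := h f ε hε hf
  refine ⟨fun t ht => h1 t (mem_relations.1 ht), fun v => ?_⟩
  let A : (Fin d → ℝ) →ₗ[ℝ] E :=
    { toFun := fun t => ∑ i, flatPoint f ε t i • x i
      map_add' := fun s t => by
        rw [← Finset.sum_add_distrib]
        refine Finset.sum_congr rfl fun i _ => ?_
        rcases hi : f i <;> simp [flatPoint, hi, mul_add, add_smul]
      map_smul' := fun c t => by
        rw [Finset.smul_sum]
        refine Finset.sum_congr rfl fun i _ => ?_
        rcases hi : f i <;> simp [flatPoint, hi, smul_smul, mul_left_comm] }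
  have hinj : Function.Injective A := by
    rw [← LinearMap.ker_eq_bot, LinearMap.ker_eq_bot']
    exact h1
  have hsurj : Function.Surjective A :=
    (LinearMap.injective_iff_surjective_of_finrank_eq_finrank (by simp [hd])).1 hinj
  obtain ⟨t, ht⟩ := hsurj (∑ i, v i • x i)
  refine ⟨t, mem_relations.2 ?_⟩
  simp only [Pi.sub_apply, sub_smul, Finset.sum_sub_distrib]
  rw [← ht]
  exact sub_self _

/-- The index of a block, where the zero block comes last. -/
def blockIndex : Option (Fin d) → ℕ := fun a => a.elim d (fun b => b)

/-- A tuple extended by zero. -/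
noncomputable def extendZero (t : Fin d → ℝ) (a : ℕ) : ℝ := if h : a < d then t ⟨a, h⟩ else 0

theorem extendZero_blockIndex (t : Fin d → ℝ) (a : Option (Fin d)) :
    extendZero t (blockIndex a) = a.elim 0 t := by
  rcases a with _ | a <;> simp [extendZero, blockIndex]

theorem extendZero_of_le (t : Fin d → ℝ) {a : ℕ} (h : d ≤ a) : extendZero t a = 0 := by
  simp [extendZero, h]

/-- The action of a signed permutation on tuples. -/
def signedPerm {M : Type*} [AddCommGroup M] (g : Equiv.Perm (Fin n) × (Fin n → ℤˣ))
    (x : Fin n → M) : Fin n → M :=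
  fun i => g.2 i • x (g.1 i)

/-- Sort the indices by block, zero block last, and move the signs into the tuple. A relation in the
flat then has coefficients constant on consecutive blocks, which general position of this signed
rearrangement excludes unless they vanish. -/
theorem isGeneric_signed [FiniteDimensional ℝ E] {x : Fin n → E} (hd : Module.finrank ℝ E = d)
    (hdn : d ≤ n) (h : ∀ g, SumsIndep d n (signedPerm g x)) :
    IsGeneric {1, -1} d (relations x) := by
  classical
  refine isGeneric_relations hd fun f ε hε hf t ht => ?_
  set σ := Tuple.sort (fun i => blockIndex (f i)) with hσ
  have hmono : Monotone (fun i => blockIndex (f (σ i))) :=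
    Tuple.monotone_sort (fun i => blockIndex (f i))
  have hz := (h (σ, fun i => if ε (σ i) = 1 then 1 else -1)).block_eq_zero hdn le_rfl hmono
    (fun i hi => absurd i.2 (not_lt.2 hi)) (t := extendZero t) (fun a => extendZero_of_le t) (by
      rw [← ht, ← Equiv.sum_comp σ (fun i => flatPoint f ε t i • x i)]
      refine Finset.sum_congr rfl fun i _ => ?_
      rw [extendZero_blockIndex]
      simp only [signedPerm, flatPoint]
      rw [smul_units_smul]
      congr 1
      have h1 := hε (σ i)
      rw [Finset.mem_insert, Finset.mem_singleton] at h1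
      rcases h1 with h1 | h1
      · simp [h1]
      · rw [h1, if_neg (by norm_num)]
        simp [Units.smul_def])
  ext a
  obtain ⟨i, hi⟩ := hf a
  have := hz (σ.symm i)
  rw [Equiv.apply_symm_apply, extendZero_blockIndex, hi] at this
  exact this

/-- The omitted last increment is put into the zero block. After sorting, the final position
therefore has coefficient zero, and general position of only `m` partial sums suffices. -/
theorem isGeneric_bridge [FiniteDimensional ℝ E] {x : Fin (m + 1) → E}
    (hd : Module.finrank ℝ E = d) (hdm : d ≤ m)
    (h : ∀ σ : Equiv.Perm (Fin (m + 1)), SumsIndep d m (x ∘ σ)) :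
    IsGeneric {1} d (relations fun i : Fin m => x i.castSucc) := by
  refine isGeneric_relations hd fun f ε hε hf t ht => ?_
  set f' : Fin (m + 1) → Option (Fin d) := Fin.snoc f none with hf'
  set σ := Tuple.sort (fun i => blockIndex (f' i)) with hσ
  have hmono : Monotone (fun i => blockIndex (f' (σ i))) :=
    Tuple.monotone_sort (fun i => blockIndex (f' i))
  have hz := (h σ).block_eq_zero hdm (Nat.le_succ m) hmono
    (fun i hi => by
      have h1 : σ.symm (Fin.last m) ≤ i := (Fin.le_last _).trans (Fin.le_def.2 (by simpa using hi))
      have h2 := hmono h1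
      simpa [hf', blockIndex] using h2) (t := extendZero t) (fun a => extendZero_of_le t) (by
      rw [← ht]
      simp only [extendZero_blockIndex, Function.comp]
      rw [Equiv.sum_comp σ (fun i => (f' i).elim 0 t • x i), Fin.sum_univ_castSucc]
      simp only [hf', Fin.snoc_castSucc, Fin.snoc_last, Option.elim_none, zero_smul, add_zero]
      refine Finset.sum_congr rfl fun i _ => ?_
      have : ε i = 1 := by simpa using hε i
      simp [flatPoint, this])
  ext a
  obtain ⟨i, hi⟩ := hf a
  have := hz (σ.symm i.castSucc)
  rw [Equiv.apply_symm_apply, extendZero_blockIndex] at this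
  simpa [hf', hi] using this

theorem exists_strictAnti_signedPerm_iff (x : Fin n → E)
    (g : Equiv.Perm (Fin n) × (Fin n → ℤˣ)) :
    (∃ c : Fin n → ℝ, StrictAnti c ∧ (∀ i, 0 < c i) ∧ ∑ i, c i • signedPerm g x i = 0) ↔
      ∃ y ∈ relations x, InChamber g y := by
  have hsum : ∀ y : Fin n → ℝ, ∑ i, (g.2 i • y (g.1 i)) • signedPerm g x i = ∑ i, y i • x i := by
    intro y
    rw [← Equiv.sum_comp g.1 (fun i => y i • x i)]
    refine Finset.sum_congr rfl fun i _ => ?_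
    rw [signedPerm, smul_units_smul, units_smul_units_smul]
  constructor
  · rintro ⟨c, hanti, hpos, h⟩
    have e : ∀ i, g.2 i • (fun j => g.2 (g.1.symm j) • c (g.1.symm j)) (g.1 i) = c i := fun i => by
      simp only [Equiv.symm_apply_apply, units_smul_units_smul]
    refine ⟨fun j => g.2 (g.1.symm j) • c (g.1.symm j), mem_relations.2 ?_, ?_, ?_⟩
    · rw [← hsum, ← h]
      exact Finset.sum_congr rfl fun i _ => by rw [e]
    · intro i j hij
      simp only [e]
      exact hanti hij
    · intro i
      rw [e]
      exact hpos i
  · rintro ⟨y, hy, hanti, hpos⟩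
    exact ⟨_, hanti, hpos, by rw [hsum]; exact mem_relations.1 hy⟩

/-- Because the increments sum to zero, a constant may be subtracted from all coefficients. One side
normalises the coefficient of the last permuted increment to zero, the other that of the last
original one. -/
theorem exists_strictAnti_perm_iff {x : Fin (m + 1) → E} (hx : ∑ i, x i = 0)
    (σ : Equiv.Perm (Fin (m + 1))) :
    (∃ c : Fin m → ℝ, StrictAnti c ∧ (∀ i, 0 < c i) ∧
        ∑ i, c i • x (σ i.castSucc) = 0) ↔
      ∃ y ∈ relations (fun i : Fin m => x i.castSucc),
        StrictAnti ((Fin.snoc y 0 : Fin (m + 1) → ℝ) ∘ σ) := by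
  constructor
  · rintro ⟨c, hanti, hpos, h⟩
    set C : Fin (m + 1) → ℝ := (Fin.snoc c 0 : Fin (m + 1) → ℝ) ∘ σ.symm with hC
    have hy : (Fin.snoc (fun j : Fin m => C j.castSucc - C (Fin.last m)) 0 : Fin (m + 1) → ℝ) =
        fun j => C j - C (Fin.last m) := by
      funext j
      induction j using Fin.lastCases <;> simp
    refine ⟨fun j => C j.castSucc - C (Fin.last m), mem_relations.2 ?_, ?_⟩
    · have h1 : ∑ j, (C j - C (Fin.last m)) • x j = 0 := by
        simp only [sub_smul, Finset.sum_sub_distrib, ← Finset.smul_sum, hx, smul_zero, sub_zero]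
        rw [← Equiv.sum_comp σ, Fin.sum_univ_castSucc]
        simpa [hC] using h
      rw [Fin.sum_univ_castSucc] at h1
      simpa using h1
    · rw [hy]
      intro i j hij
      simp only [Function.comp, hC, Equiv.symm_apply_apply]
      refine sub_lt_sub_right ?_ _
      induction j using Fin.lastCases with
      | last =>
        induction i using Fin.lastCases with
        | last => exact absurd hij (lt_irrefl _)
        | cast i => simpa using hpos i
      | cast j =>
        induction i using Fin.lastCases with
        | last => exact absurd hij (not_lt.2 (Fin.le_last _))
        | cast i => simpa using hanti (Fin.castSucc_lt_castSucc_iff.1 hij)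
  · rintro ⟨y, hy, hanti⟩
    set C : Fin (m + 1) → ℝ := Fin.snoc y 0 with hC
    refine ⟨fun i => C (σ i.castSucc) - C (σ (Fin.last m)), fun i j hij => ?_, fun i => ?_, ?_⟩
    · exact sub_lt_sub_right (hanti (Fin.castSucc_lt_castSucc_iff.2 hij)) _
    · exact sub_pos.2 (hanti (Fin.castSucc_lt_last i))
    · have h1 : ∑ i, (C (σ i) - C (σ (Fin.last m))) • x (σ i) = 0 := by
        rw [Equiv.sum_comp σ (fun j => (C j - C (σ (Fin.last m))) • x j)]
        simp only [sub_smul, Finset.sum_sub_distrib, ← Finset.smul_sum, hx, smul_zero, sub_zero]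
        rw [Fin.sum_univ_castSucc]
        simpa [hC] using mem_relations.1 hy
      rw [Fin.sum_univ_castSucc] at h1
      simpa using h1

/-- The number of signed permutations for which the hull of the partial sums contains the origin. -/
theorem ncard_signed_absorbing [FiniteDimensional ℝ E] {x : Fin n → E}
    (hd : Module.finrank ℝ E = d) (hdn : d ≤ n) (hn : 0 < n)
    (h : ∀ g, SumsIndep d n (signedPerm g x)) :
    ({g | (0 : E) ∈ convexHull ℝ (partialSum (signedPerm g x) '' Set.Icc 1 n)}.ncard : ℝ) =
      Fintype.card (Equiv.Perm (Fin n) × (Fin n → ℤˣ)) * (1 - bernoulliCdf 2 n d) := by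
  have hS : IsSignSet {1, -1} :=
    ⟨by simp, by simp, by simp⟩
  have hc : ({1, -1} : Finset ℝ).card = 2 := Finset.card_pair (by norm_num)
  have h1 : {g | (0 : E) ∈ convexHull ℝ (partialSum (signedPerm g x) '' Set.Icc 1 n)} =
      {g | ∃ y ∈ relations x, InChamber g y} := by
    ext g
    change (0 : E) ∈ convexHull ℝ (partialSum (signedPerm g x) '' Set.Icc 1 n) ↔
      ∃ y ∈ relations x, InChamber g y
    have h2 := h g
    rw [← hd] at h2
    rw [← exists_strictAnti_signedPerm_iff, h2.zero_mem_iff (by omega) le_rfl hn]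
    rfl
  rw [h1, ncard_signed_chambers, (isGeneric_signed hd hdn h).numRegions_eq hS hdn, hc]
  congr 1
  -- What remains is `∏ (2 + 2 j) = 2 ^ n * n!`, the order of the group.
  rw [Fintype.card_prod, Fintype.card_perm, Fintype.card_fun, Fintype.card_fin,
    Fintype.card_units_int]
  push_cast
  clear h h1 hdn hn x
  induction n with
  | zero => simp
  | succ n ih =>
    rw [Finset.prod_range_succ, ih, Nat.factorial_succ]
    push_cast
    ring

/-- The number of permutations for which the hull of the partial sums of a bridge contains the
origin. -/
theorem ncard_perm_absorbing [FiniteDimensional ℝ E] {x : Fin (m + 1) → E}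
    (hd : Module.finrank ℝ E = d) (hdm : d ≤ m) (hm : 0 < m) (hx : ∑ i, x i = 0)
    (h : ∀ σ : Equiv.Perm (Fin (m + 1)), SumsIndep d m (x ∘ σ)) :
    ({σ : Equiv.Perm (Fin (m + 1)) |
      (0 : E) ∈ convexHull ℝ (partialSum (x ∘ σ) '' Set.Icc 1 m)}.ncard : ℝ) =
      Fintype.card (Equiv.Perm (Fin (m + 1))) * (1 - bernoulliCdf 1 m d) := by
  have hS : IsSignSet {1} := ⟨by simp, by simp, by simp⟩
  have h1 : {σ : Equiv.Perm (Fin (m + 1)) |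
      (0 : E) ∈ convexHull ℝ (partialSum (x ∘ σ) '' Set.Icc 1 m)} =
      {σ : Equiv.Perm (Fin (m + 1)) | ∃ y ∈ relations (fun i : Fin m => x i.castSucc),
        StrictAnti ((Fin.snoc y 0 : Fin (m + 1) → ℝ) ∘ σ)} := by
    ext σ
    change (0 : E) ∈ convexHull ℝ (partialSum (x ∘ σ) '' Set.Icc 1 m) ↔
      ∃ y ∈ relations (fun i : Fin m => x i.castSucc),
        StrictAnti ((Fin.snoc y 0 : Fin (m + 1) → ℝ) ∘ σ)
    have h2 := h σ
    rw [← hd] at h2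
    rw [← exists_strictAnti_perm_iff hx, h2.zero_mem_iff (by omega) (Nat.le_succ m) hm]
    rfl
  rw [h1, ncard_perm_chambers, (isGeneric_bridge hd hdm h).numRegions_eq hS hdm,
    Finset.card_singleton]
  congr 1
  rw [Fintype.card_perm, Fintype.card_fin]
  clear h h1 hdm hm hx x
  induction m with
  | zero => simp
  | succ n ih =>
    rw [Finset.prod_range_succ, ih, Nat.factorial_succ (n + 1)]
    push_cast
    ring

end Counting

/-! ### Averaging over the group, and measurability. -/

section Averaging

variable {Ω : Type*} [MeasurableSpace Ω] {P : Measure Ω} [IsProbabilityMeasure P]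

theorem sum_measureReal_eq_of_ae_ncard {G : Type*} [Fintype G] {A : G → Set Ω}
    (hA : ∀ g, MeasurableSet (A g)) {c : ℝ} (h : ∀ᵐ ω ∂P, ({g | ω ∈ A g}.ncard : ℝ) = c) :
    ∑ g, P.real (A g) = c := by
  classical
  have h1 : ∫ ω, ∑ g, (A g).indicator (fun _ => (1 : ℝ)) ω ∂P = ∑ g, P.real (A g) := by
    rw [integral_finsetSum _ fun g _ => (integrable_const 1).indicator (hA g)]
    exact Finset.sum_congr rfl fun g _ => by simp [integral_indicator (hA g)]
  have h2 : ∫ ω, ∑ g, (A g).indicator (fun _ => (1 : ℝ)) ω ∂P = ∫ _, c ∂P := by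
    refine integral_congr_ae ?_
    filter_upwards [h] with ω hω
    rw [← hω, Set.ncard_eq_toFinset_card']
    simp [Set.indicator_apply]
  rw [← h1, h2]
  simp

end Averaging

section Measurability

variable {n m d : ℕ}

theorem continuous_partialSum (k : ℕ) :
    Continuous fun x : Fin n → EuclideanSpace ℝ (Fin d) => partialSum x k := by
  unfold partialSum
  fun_prop

/-- The tuples for which the hull of `S_1, ..., S_m` contains the origin. -/
def absorbing (n d m : ℕ) : Set (Fin n → EuclideanSpace ℝ (Fin d)) :=
  {x | (0 : EuclideanSpace ℝ (Fin d)) ∈ convexHull ℝ (partialSum x '' Set.Icc 1 m)}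

/-- The set is the projection of a closed set along the compact simplex of convex weights. -/
theorem isClosed_absorbing : IsClosed (absorbing n d m) := by
  have hcomp : CompactSpace (stdSimplex ℝ (Fin m)) :=
    isCompact_iff_compactSpace.1 (isCompact_stdSimplex ℝ (Fin m))
  have h : absorbing n d m = Prod.snd ''
      {p : stdSimplex ℝ (Fin m) × (Fin n → EuclideanSpace ℝ (Fin d)) |
        ∑ k, (p.1 : Fin m → ℝ) k • partialSum p.2 (k + 1) = 0} := by
    ext x
    change 0 ∈ convexHull ℝ (partialSum x '' Set.Icc 1 m) ↔ _
    rw [image_partialSum_Icc, convexHull_range_eq_image_stdSimplex]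
    constructor
    · rintro ⟨c, hc, h⟩
      exact ⟨(⟨c, hc⟩, x), h, rfl⟩
    · rintro ⟨⟨c, y⟩, h, rfl⟩
      exact ⟨c, c.2, h⟩
  rw [h]
  refine isClosedMap_snd_of_compactSpace _ (isClosed_eq ?_ continuous_const)
  refine continuous_finsetSum _ fun k _ => ?_
  have h1 : Continuous fun p : stdSimplex ℝ (Fin m) × (Fin n → EuclideanSpace ℝ (Fin d)) =>
      (p.1 : Fin m → ℝ) k :=
    (continuous_apply k).comp (continuous_subtype_val.comp continuous_fst)
  have h2 : Continuous fun p : stdSimplex ℝ (Fin m) × (Fin n → EuclideanSpace ℝ (Fin d)) =>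
      partialSum p.2 (k + 1) := (continuous_partialSum _).comp continuous_snd
  exact h1.smul h2

theorem measurableSet_absorbing : MeasurableSet (absorbing n d m) :=
  isClosed_absorbing.measurableSet

variable {Ω : Type*} [MeasurableSpace Ω] {P : Measure Ω}
  {ξ η : Ω → Fin n → EuclideanSpace ℝ (Fin d)}

theorem GeneralPosition.ae_sumsIndep (h : GeneralPosition P ξ m) :
    ∀ᵐ ω ∂P, SumsIndep d m (ξ ω) := by
  simp only [SumsIndep, ae_all_iff]
  exact h

/-- Linear independence is an open condition, hence a measurable event determined by the law. -/
theorem GeneralPosition.of_identDistrib (h : GeneralPosition P ξ m) (hid : IdentDistrib ξ η P P) :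
    GeneralPosition P η m := by
  intro I hI hd
  have hopen : IsOpen {x : Fin n → EuclideanSpace ℝ (Fin d) |
      LinearIndependent ℝ (fun k : I => partialSum x (k : ℕ))} :=
    isOpen_setOfPred_linearIndependent.preimage
      (continuous_pi fun k : I => continuous_partialSum (n := n) (d := d) (k : ℕ))
  exact hid.ae_snd hopen.measurableSet (h I hI hd)

theorem measureReal_absorbing_eq (hid : IdentDistrib ξ η P P) :
    P.real {ω | ξ ω ∈ absorbing n d m} = P.real {ω | η ω ∈ absorbing n d m} := by
  rw [Measure.real, Measure.real]
  congr 1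
  exact hid.measure_mem_eq measurableSet_absorbing

theorem measurable_signedPerm (g : Equiv.Perm (Fin n) × (Fin n → ℤˣ)) :
    Measurable (signedPerm g : (Fin n → EuclideanSpace ℝ (Fin d)) → _) := by
  refine measurable_pi_lambda _ fun i => ?_
  rcases Int.units_eq_one_or (g.2 i) with h | h
  · simp only [signedPerm, h, one_smul]
    fun_prop
  · simp only [signedPerm, h, Units.smul_def, Units.val_neg, Units.val_one, neg_smul, one_smul]
    fun_prop

end Measurability

/-! ### Exact probabilities in types A and B. -/

section NonAbsorption

variable {Ω : Type*} [MeasurableSpace Ω] {P : Measure Ω} [IsProbabilityMeasure P] {n m d : ℕ}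

/-- Almost surely the number of absorbing permutations is the same constant, and by exchangeability
each permutation absorbs with the same probability; that probability is the constant divided by the
order of the group. -/
theorem IsTypeA.nonAbsorption_eq {ξ : Ω → Fin (m + 1) → EuclideanSpace ℝ (Fin d)}
    (h : IsTypeA P ξ) (hm : 0 < m) : nonAbsorption .A P ξ = bernoulliCdf 1 m d := by
  have hdm : d ≤ m := by have := h.le; omega
  have hgp : ∀ᵐ ω ∂P, ∀ σ : Equiv.Perm (Fin (m + 1)), SumsIndep d m (ξ ω ∘ σ) :=
    ae_all_iff.2 fun σ => (h.general.of_identDistrib (h.exchangeable σ)).ae_sumsIndep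
  have hmeas : ∀ σ : Equiv.Perm (Fin (m + 1)),
      MeasurableSet {ω | ξ ω ∘ σ ∈ absorbing (m + 1) d m} := fun σ => by
    have : Measurable fun ω => ξ ω ∘ σ :=
      measurable_pi_lambda _ fun i => (measurable_pi_apply (σ i)).comp h.measurable
    exact this measurableSet_absorbing
  have hsum := sum_measureReal_eq_of_ae_ncard (P := P) hmeas
    (c := Fintype.card (Equiv.Perm (Fin (m + 1))) * (1 - bernoulliCdf 1 m d)) (by
      filter_upwards [hgp, h.bridge] with ω hω hb
      rw [partialSum_self] at hb
      exact ncard_perm_absorbing finrank_euclideanSpace_fin hdm hm hb hω)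
  have hconst : ∀ σ : Equiv.Perm (Fin (m + 1)), P.real {ω | ξ ω ∘ σ ∈ absorbing (m + 1) d m} =
      P.real {ω | ξ ω ∈ absorbing (m + 1) d m} := fun σ =>
    (measureReal_absorbing_eq (h.exchangeable σ)).symm
  simp only [hconst, Finset.sum_const, Finset.card_univ, nsmul_eq_mul] at hsum
  have hne : (Fintype.card (Equiv.Perm (Fin (m + 1))) : ℝ) ≠ 0 := by
    exact_mod_cast Fintype.card_ne_zero
  have hp := mul_left_cancel₀ hne hsum
  have hcompl : nonAbsorption .A P ξ = P.real {ω | ξ ω ∈ absorbing (m + 1) d m}ᶜ := rfl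
  have hms : MeasurableSet {ω | ξ ω ∈ absorbing (m + 1) d m} := h.measurable measurableSet_absorbing
  rw [hcompl, probReal_compl_eq_one_sub hms, hp]
  ring

theorem IsTypeB.measureReal_absorbing {ξ : Ω → Fin n → EuclideanSpace ℝ (Fin d)}
    (h : IsTypeB P ξ) (hn : 0 < n) :
    P.real {ω | ξ ω ∈ absorbing n d n} = 1 - bernoulliCdf 2 n d := by
  have hgp : ∀ᵐ ω ∂P, ∀ g, SumsIndep d n (signedPerm g (ξ ω)) :=
    ae_all_iff.2 fun g => (h.general.of_identDistrib (h.exchangeable g.1 g.2)).ae_sumsIndep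
  have hsum := sum_measureReal_eq_of_ae_ncard (P := P)
    (A := fun g => {ω | signedPerm g (ξ ω) ∈ absorbing n d n})
    (fun g => ((measurable_signedPerm g).comp h.measurable) measurableSet_absorbing)
    (c := Fintype.card (Equiv.Perm (Fin n) × (Fin n → ℤˣ)) * (1 - bernoulliCdf 2 n d)) (by
      filter_upwards [hgp] with ω hω
      exact ncard_signed_absorbing finrank_euclideanSpace_fin h.le hn hω)
  have hconst : ∀ g, P.real {ω | signedPerm g (ξ ω) ∈ absorbing n d n} =
      P.real {ω | ξ ω ∈ absorbing n d n} := fun g =>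
    (measureReal_absorbing_eq (h.exchangeable g.1 g.2)).symm
  simp only [hconst, Finset.sum_const, Finset.card_univ, nsmul_eq_mul] at hsum
  refine mul_left_cancel₀ ?_ hsum
  exact_mod_cast Fintype.card_ne_zero

theorem IsTypeB.nonAbsorption_eq {ξ : Ω → Fin n → EuclideanSpace ℝ (Fin d)}
    (h : IsTypeB P ξ) (hn : 0 < n) : nonAbsorption .B P ξ = bernoulliCdf 2 n d := by
  have hcompl : nonAbsorption .B P ξ = P.real {ω | ξ ω ∈ absorbing n d n}ᶜ := rfl
  have hms : MeasurableSet {ω | ξ ω ∈ absorbing n d n} := h.measurable measurableSet_absorbing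
  rw [hcompl, probReal_compl_eq_one_sub hms,
    h.measureReal_absorbing hn]
  ring

end NonAbsorption

/-! ### Type D, squeezed between type B quantities. -/

section TypeD

/-- The midpoint `v` of `a` and `b` is available, so the smaller of their weights can be traded,
together with an equal part of the larger, for weight on `v`. One of the two points is then no
longer needed. -/
theorem zero_mem_convexHull_insert_insert {E : Type*} [AddCommGroup E] [Module ℝ E] {V : Set E}
    {a b v : E} (hv : v ∈ V) (hab : a + b = (2 : ℝ) • v)
    (h : (0 : E) ∈ convexHull ℝ (insert b (insert a V))) :
    (0 : E) ∈ convexHull ℝ (insert a V) ∨ (0 : E) ∈ convexHull ℝ (insert b V) := by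
  rw [convexHull_insert ⟨a, Set.mem_insert _ _⟩, convexHull_insert ⟨v, hv⟩] at h
  simp only [mem_convexJoin, Set.mem_singleton_iff, exists_eq_left] at h
  obtain ⟨z, ⟨w, hw, α, γ, hα, hγ, hαγ, rfl⟩, β, δ, hβ, hδ, hβδ, h0⟩ := h
  have key : ∀ (a' : E) (p q : ℝ), 0 ≤ p → 0 ≤ q → p + 2 * q + δ * γ = 1 →
      p • a' + (2 * q) • v + (δ * γ) • w ∈ convexHull ℝ (insert a' V) := by
    intro a' p q hp hq h1
    have := (convex_convexHull ℝ (insert a' V)).sum_mem (t := Finset.univ)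
      (w := ![p, 2 * q, δ * γ]) (z := ![a', v, w])
      (fun i _ => by fin_cases i <;> simp <;> positivity)
      (by simpa [Fin.sum_univ_three] using h1)
      (fun i _ => by
        fin_cases i
        · exact subset_convexHull ℝ _ (Set.mem_insert _ _)
        · exact subset_convexHull ℝ _ (Set.mem_insert_of_mem _ hv)
        · exact convexHull_mono (Set.subset_insert _ _) hw)
    simpa [Fin.sum_univ_three] using this
  have h1 : β + δ * α + δ * γ = 1 := by rw [add_assoc, ← mul_add, hαγ, mul_one, hβδ]
  rcases le_total β (δ * α) with hle | hle
  · left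
    rw [← h0]
    convert key a (δ * α - β) β (by linarith) hβ (by linarith) using 1
    have : b = (2 : ℝ) • v - a := by rw [← hab]; abel
    rw [this]
    module
  · right
    rw [← h0]
    convert key b (β - δ * α) (δ * α) (by linarith) (by positivity) (by linarith) using 1
    have : a = (2 : ℝ) • v - b := by rw [← hab]; abel
    rw [this]
    module

section Flip

variable {E : Type*} [AddCommGroup E] {m : ℕ}

theorem flipLast_castSucc (x : Fin (m + 1) → E) (i : Fin m) :
    flipLast x i.castSucc = x i.castSucc := by
  simp [flipLast, i.2.ne]

theorem flipLast_last (x : Fin (m + 1) → E) : flipLast x (Fin.last m) = -x (Fin.last m) := by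
  simp [flipLast]

theorem partialSum_congr_of_le {n n' : ℕ} {x : Fin n → E} {y : Fin n' → E} {k : ℕ} (hn : k ≤ n)
    (hn' : k ≤ n') (h : ∀ (i : ℕ) (hi : i < k), x ⟨i, hi.trans_le hn⟩ = y ⟨i, hi.trans_le hn'⟩) :
    partialSum x k = partialSum y k := by
  induction k with
  | zero => simp [partialSum_zero]
  | succ k ih =>
    rw [partialSum_succ x (by omega), partialSum_succ y (by omega), h k (by omega),
      ih (by omega) (by omega) fun i hi => h i (by omega)]

theorem partialSum_flipLast (x : Fin (m + 1) → E) {k : ℕ} (hk : k ≤ m) :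
    partialSum (flipLast x) k = partialSum x k :=
  partialSum_congr_of_le (by omega) (by omega) fun i hi =>
    flipLast_castSucc x ⟨i, by omega⟩

theorem image_partialSum_flipLast (x : Fin (m + 1) → E) :
    partialSum (flipLast x) '' Set.Icc 1 m = partialSum x '' Set.Icc 1 m :=
  Set.image_congr fun _ hk => partialSum_flipLast x hk.2

theorem image_partialSum_Icc_succ (x : Fin (m + 1) → E) :
    partialSum x '' Set.Icc 1 (m + 1) =
      insert (partialSum x (m + 1)) (partialSum x '' Set.Icc 1 m) := by
  rw [← Set.image_insert_eq]
  congr 1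
  ext k
  simp only [Set.mem_Icc, Set.mem_insert_iff]
  omega

end Flip

variable {m d : ℕ}

theorem zero_mem_hull_D_iff (hm : 0 < m) (x : Fin (m + 1) → EuclideanSpace ℝ (Fin d)) :
    (0 : EuclideanSpace ℝ (Fin d)) ∈ hull .D x ↔
      x ∈ absorbing (m + 1) d (m + 1) ∨ flipLast x ∈ absorbing (m + 1) d (m + 1) := by
  change (0 : EuclideanSpace ℝ (Fin d)) ∈ convexHull ℝ (insert (partialSum (flipLast x) (m + 1))
      (partialSum x '' Set.Icc 1 (m + 1))) ↔
    (0 : EuclideanSpace ℝ (Fin d)) ∈ convexHull ℝ (partialSum x '' Set.Icc 1 (m + 1)) ∨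
    (0 : EuclideanSpace ℝ (Fin d)) ∈ convexHull ℝ (partialSum (flipLast x) '' Set.Icc 1 (m + 1))
  rw [image_partialSum_Icc_succ, image_partialSum_Icc_succ, image_partialSum_flipLast]
  constructor
  · refine zero_mem_convexHull_insert_insert (v := partialSum x m) ⟨m, ⟨hm, le_rfl⟩, rfl⟩ ?_
    rw [partialSum_succ x (Nat.lt_succ_self m), partialSum_succ (flipLast x) (Nat.lt_succ_self m),
      partialSum_flipLast x le_rfl]
    have : flipLast x ⟨m, Nat.lt_succ_self m⟩ = -x ⟨m, Nat.lt_succ_self m⟩ := flipLast_last x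
    rw [this]
    module
  · rintro (h | h)
    · exact convexHull_mono (Set.subset_insert _ _) h
    · exact convexHull_mono (Set.insert_subset_insert (Set.subset_insert _ _)) h

/-- The signed permutation `g` followed by a change of the last sign. -/
def flipSign (g : Equiv.Perm (Fin (m + 1)) × (Fin (m + 1) → ℤˣ)) :
    Equiv.Perm (Fin (m + 1)) × (Fin (m + 1) → ℤˣ) :=
  (g.1, fun i => if (i : ℕ) + 1 = m + 1 then -g.2 i else g.2 i)

theorem flipSign_involutive : Function.Involutive (flipSign (m := m)) := by
  intro g
  refine Prod.ext rfl (funext fun i => ?_)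
  simp only [flipSign]
  split_ifs <;> simp

theorem signedPerm_flipSign {E : Type*} [AddCommGroup E]
    (g : Equiv.Perm (Fin (m + 1)) × (Fin (m + 1) → ℤˣ)) (x : Fin (m + 1) → E) :
    signedPerm (flipSign g) x = flipLast (signedPerm g x) := by
  funext i
  simp only [signedPerm, flipSign, flipLast]
  split_ifs
  · simp [Units.smul_def]
  · rfl

theorem prod_flipSign (g : Equiv.Perm (Fin (m + 1)) × (Fin (m + 1) → ℤˣ)) :
    ∏ i, (flipSign g).2 i = -∏ i, g.2 i := by
  rw [Fin.prod_univ_castSucc, Fin.prod_univ_castSucc]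
  have h1 : ∀ i : Fin m, (flipSign g).2 i.castSucc = g.2 i.castSucc := fun i => by
    simp [flipSign, i.2.ne]
  have h2 : (flipSign g).2 (Fin.last m) = -g.2 (Fin.last m) := by simp [flipSign]
  simp only [h1, h2, mul_neg]

theorem measurable_flipLast :
    Measurable (flipLast : (Fin (m + 1) → EuclideanSpace ℝ (Fin d)) → _) := by
  refine measurable_pi_lambda _ fun i => ?_
  simp only [flipLast]
  split_ifs <;> fun_prop

variable {Ω : Type*} [MeasurableSpace Ω] {P : Measure Ω}
  {ξ : Ω → Fin (m + 1) → EuclideanSpace ℝ (Fin d)}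

/-- Up to a flip of the last sign, a type `D` tuple is invariant under all signed permutations. -/
theorem IsTypeD.identDistrib (h : IsTypeD P ξ)
    (g : Equiv.Perm (Fin (m + 1)) × (Fin (m + 1) → ℤˣ)) :
    (IdentDistrib ξ (fun ω => signedPerm g (ξ ω)) P P ∧
        IdentDistrib (fun ω => flipLast (ξ ω)) (fun ω => signedPerm (flipSign g) (ξ ω)) P P) ∨
      (IdentDistrib ξ (fun ω => signedPerm (flipSign g) (ξ ω)) P P ∧
        IdentDistrib (fun ω => flipLast (ξ ω)) (fun ω => signedPerm g (ξ ω)) P P) := by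
  have key : ∀ g : Equiv.Perm (Fin (m + 1)) × (Fin (m + 1) → ℤˣ), ∏ i, g.2 i = 1 →
      IdentDistrib ξ (fun ω => signedPerm g (ξ ω)) P P ∧
        IdentDistrib (fun ω => flipLast (ξ ω)) (fun ω => signedPerm (flipSign g) (ξ ω)) P P := by
    intro g hg
    have h1 := h.exchangeable g.1 g.2 hg
    refine ⟨h1, ?_⟩
    simp only [signedPerm_flipSign]
    exact h1.comp measurable_flipLast
  rcases Int.units_eq_one_or (∏ i, g.2 i) with hg | hg
  · exact Or.inl (key g hg)
  · have := key (flipSign g) (by rw [prod_flipSign, hg, neg_neg])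
    rw [flipSign_involutive g] at this
    exact Or.inr this

theorem IsTypeD.generalPosition_signedPerm (h : IsTypeD P ξ)
    (g : Equiv.Perm (Fin (m + 1)) × (Fin (m + 1) → ℤˣ)) :
    GeneralPosition P (fun ω => signedPerm g (ξ ω)) (m + 1) := by
  rcases h.identDistrib g with ⟨h1, _⟩ | ⟨_, h2⟩
  · exact h.general.of_identDistrib h1
  · exact h.general_star.of_identDistrib h2

/-- Of `g` and `flipSign g` exactly one has an even number of sign changes, so the two
rearrangements have the laws of `ξ` and of its flip in some order. The count over all signed
permutations thus determines the sum of the two probabilities, though not each of them. -/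
theorem IsTypeD.measureReal_add [IsProbabilityMeasure P] (h : IsTypeD P ξ) :
    P.real {ω | ξ ω ∈ absorbing (m + 1) d (m + 1)} +
      P.real {ω | flipLast (ξ ω) ∈ absorbing (m + 1) d (m + 1)} =
      2 * (1 - bernoulliCdf 2 (m + 1) d) := by
  have hd : d ≤ m + 1 := (le_max_right _ _).trans h.le
  have hgp : ∀ᵐ ω ∂P, ∀ g, SumsIndep d (m + 1) (signedPerm g (ξ ω)) :=
    ae_all_iff.2 fun g => (h.generalPosition_signedPerm g).ae_sumsIndep
  have hsum := sum_measureReal_eq_of_ae_ncard (P := P)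
    (A := fun g => {ω | signedPerm g (ξ ω) ∈ absorbing (m + 1) d (m + 1)})
    (fun g => ((measurable_signedPerm g).comp h.measurable) measurableSet_absorbing)
    (c := Fintype.card (Equiv.Perm (Fin (m + 1)) × (Fin (m + 1) → ℤˣ)) *
      (1 - bernoulliCdf 2 (m + 1) d)) (by
      filter_upwards [hgp] with ω hω
      exact ncard_signed_absorbing finrank_euclideanSpace_fin hd (Nat.succ_pos m) hω)
  have hflip : ∑ g, P.real {ω | signedPerm (flipSign g) (ξ ω) ∈ absorbing (m + 1) d (m + 1)} =
      ∑ g, P.real {ω | signedPerm g (ξ ω) ∈ absorbing (m + 1) d (m + 1)} :=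
    Equiv.sum_comp flipSign_involutive.toPerm
      (fun g => P.real {ω | signedPerm g (ξ ω) ∈ absorbing (m + 1) d (m + 1)})
  have hpair : ∀ g, P.real {ω | signedPerm g (ξ ω) ∈ absorbing (m + 1) d (m + 1)} +
      P.real {ω | signedPerm (flipSign g) (ξ ω) ∈ absorbing (m + 1) d (m + 1)} =
      P.real {ω | ξ ω ∈ absorbing (m + 1) d (m + 1)} +
      P.real {ω | flipLast (ξ ω) ∈ absorbing (m + 1) d (m + 1)} := fun g => by
    rcases h.identDistrib g with ⟨h1, h2⟩ | ⟨h1, h2⟩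
    · rw [measureReal_absorbing_eq h1, measureReal_absorbing_eq h2]
    · rw [measureReal_absorbing_eq h1, measureReal_absorbing_eq h2, add_comm]
  have htot := Finset.sum_congr (rfl : Finset.univ = Finset.univ) fun g _ => hpair g
  rw [Finset.sum_add_distrib, hflip, hsum, Finset.sum_const, Finset.card_univ, nsmul_eq_mul,
    ← mul_add] at htot
  have hne : (Fintype.card (Equiv.Perm (Fin (m + 1)) × (Fin (m + 1) → ℤˣ)) : ℝ) ≠ 0 := by
    exact_mod_cast Fintype.card_ne_zero
  rw [← mul_left_cancel₀ hne htot]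
  ring

theorem partialSum_init {E : Type*} [AddCommGroup E] (x : Fin (m + 1) → E) {k : ℕ} (hk : k ≤ m) :
    partialSum (fun i : Fin m => x i.castSucc) k = partialSum x k :=
  partialSum_congr_of_le hk (by omega) fun _ _ => rfl

/-- Without its last increment, a type `D` tuple is of type `B`. -/
theorem IsTypeD.isTypeB_init (h : IsTypeD P ξ) (hd : d ≤ m) :
    IsTypeB P (fun ω (i : Fin m) => ξ ω i.castSucc) := by
  have hinit : Measurable fun (x : Fin (m + 1) → EuclideanSpace ℝ (Fin d)) (i : Fin m) =>
      x i.castSucc := by fun_prop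
  refine ⟨hinit.comp h.measurable, fun σ ε => ?_, hd, fun I hI hId => ?_⟩
  -- The discarded last increment receives the sign `∏ ε i`, which makes the total number of sign
  -- changes even.
  · have h1 := h.exchangeable
      (finSuccEquivLast.trans ((Equiv.optionCongr σ).trans finSuccEquivLast.symm))
      (Fin.snoc ε (∏ i, ε i))
      (by rw [Fin.prod_univ_castSucc]; simp [Int.units_mul_self])
    have h2 := h1.comp hinit
    simpa [Function.comp_def] using h2
  · filter_upwards [h.general I (hI.trans (Finset.Icc_subset_Icc_right (Nat.le_succ m))) hId]
      with ω hω
    convert hω using 2 with k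
    exact partialSum_init (ξ ω) (Finset.mem_Icc.1 (hI k.2)).2

/-- With `A`, `A'` the two type B absorption events, `P(A) + P(A')` is known, and `A ∩ A'` contains
absorption by the first `m` partial sums, whose probability is known or bounded below by zero.
Inclusion–exclusion gives one bound, monotonicity the other. -/
theorem IsTypeD.nonAbsorption_bounds [IsProbabilityMeasure P] (h : IsTypeD P ξ) :
    2 * bernoulliCdf 2 (m + 1) d - bernoulliCdf 2 m d ≤ nonAbsorption .D P ξ ∧
      nonAbsorption .D P ξ ≤ bernoulliCdf 2 m d := by
  have hm : 0 < m := by have := (le_max_left _ _).trans h.le; omega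
  set A := {ω | ξ ω ∈ absorbing (m + 1) d (m + 1)} with hA
  set A' := {ω | flipLast (ξ ω) ∈ absorbing (m + 1) d (m + 1)} with hA'
  set C := {ω | ξ ω ∈ absorbing (m + 1) d m} with hC
  have hAm : MeasurableSet A := h.measurable measurableSet_absorbing
  have hA'm : MeasurableSet A' :=
    (measurable_flipLast.comp h.measurable) measurableSet_absorbing
  have hsub : Set.Icc 1 m ⊆ Set.Icc 1 (m + 1) := Set.Icc_subset_Icc_right (Nat.le_succ m)
  have hCA : C ⊆ A ∩ A' := by
    intro ω hω
    have hω : (0 : EuclideanSpace ℝ (Fin d)) ∈ convexHull ℝ (partialSum (ξ ω) '' Set.Icc 1 m) := hω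
    refine ⟨convexHull_mono (Set.image_mono hsub) hω, ?_⟩
    rw [← image_partialSum_flipLast] at hω
    exact convexHull_mono (Set.image_mono hsub) hω
  have hcompl : nonAbsorption .D P ξ = P.real (A ∪ A')ᶜ := by
    rw [nonAbsorption]
    congr 1
    ext ω
    exact not_congr (zero_mem_hull_D_iff hm (ξ ω))
  have hadd := h.measureReal_add
  have hunion := measureReal_union_add_inter (μ := P) (s := A) hA'm
  have hCle : P.real C ≤ P.real (A ∩ A') := measureReal_mono hCA
  have hCle' : P.real C ≤ P.real (A ∪ A') :=
    measureReal_mono (hCA.trans (Set.inter_subset_left.trans Set.subset_union_left))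
  have hCge : 1 - bernoulliCdf 2 m d ≤ P.real C := by
    -- If `d > m` the shortened walk is not of type B, but then the claimed lower bound is zero.
    rcases Nat.lt_or_ge m d with hlt | hge
    · obtain ⟨k, rfl⟩ : ∃ k, m = k + 1 := ⟨m - 1, by omega⟩
      rw [bernoulliCdf_of_le 2 hlt.le, sub_self]
      exact measureReal_nonneg
    · refine ((h.isTypeB_init hge).measureReal_absorbing hm).symm.le.trans_eq ?_
      congr 1
      ext ω
      have e : partialSum (fun i : Fin m => ξ ω i.castSucc) '' Set.Icc 1 m =
          partialSum (ξ ω) '' Set.Icc 1 m :=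
        Set.image_congr fun k hk => partialSum_init (ξ ω) hk.2
      change _ ∈ convexHull ℝ (partialSum (fun i : Fin m => ξ ω i.castSucc) '' Set.Icc 1 m) ↔
        _ ∈ convexHull ℝ (partialSum (ξ ω) '' Set.Icc 1 m)
      rw [e]
  rw [hcompl, probReal_compl_eq_one_sub (hAm.union hA'm)]
  constructor <;> linarith

end TypeD

/-! ### Means of the Bernoulli sums and limits of their distribution functions. -/

section Parameters

theorem sum_bernoulliParam_sq_le {k : ℕ} (hk : 1 ≤ k) (m : ℕ) :
    ∑ j ∈ Finset.range m, bernoulliParam k j ^ 2 ≤ 1 := by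
  have hterm : ∀ j : ℕ, bernoulliParam k j ^ 2 ≤ 1 / ((j : ℝ) + 1) - 1 / ((j : ℝ) + 2) := by
    intro j
    have e : 1 / ((j : ℝ) + 1) - 1 / ((j : ℝ) + 2) = 1 / (((j : ℝ) + 1) * (j + 2)) := by
      field_simp
      ring
    rw [e, bernoulliParam]
    split_ifs
    · rw [zero_pow two_ne_zero]
      positivity
    · have hk' : (1 : ℝ) ≤ k := by exact_mod_cast hk
      have hj : (0 : ℝ) ≤ j := Nat.cast_nonneg j
      rw [div_pow, one_pow]
      refine one_div_le_one_div_of_le (by positivity) ?_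
      nlinarith [mul_le_mul_of_nonneg_right hk' hj]
  have h : ∑ j ∈ Finset.range m, bernoulliParam k j ^ 2 ≤ 1 - 1 / ((m : ℝ) + 1) := by
    induction m with
    | zero => simp
    | succ m ih =>
      rw [Finset.sum_range_succ]
      have := hterm m
      push_cast
      rw [show (m : ℝ) + 1 + 1 = m + 2 by ring]
      linarith
  have : 0 ≤ 1 / ((m : ℝ) + 1) := by positivity
  linarith

theorem sum_bernoulliParam_one (m : ℕ) :
    ∑ j ∈ Finset.range (m + 1), bernoulliParam 1 j = (harmonic (m + 2) : ℝ) - 3 / 2 := by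
  induction m with
  | zero => norm_num [bernoulliParam, harmonic_succ]
  | succ m ih =>
    rw [Finset.sum_range_succ, ih, harmonic_succ (m + 2), bernoulliParam, if_neg (by omega)]
    push_cast
    field_simp
    ring

/-- The parameters `1/(2 + 2j)` are half the harmonic terms, whence `u = 1/2` in types B and D. -/
theorem sum_bernoulliParam_two (m : ℕ) :
    ∑ j ∈ Finset.range (m + 1), bernoulliParam 2 j = (harmonic (m + 1) : ℝ) / 2 - 1 / 2 := by
  induction m with
  | zero => norm_num [bernoulliParam, harmonic_succ]
  | succ m ih =>
    rw [Finset.sum_range_succ, ih, harmonic_succ (m + 1), bernoulliParam, if_neg (by omega)]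
    push_cast
    field_simp
    ring

theorem abs_harmonic_sub_log_le {n : ℕ} (hn : 1 ≤ n) : |(harmonic n : ℝ) - Real.log n| ≤ 1 := by
  have h1 := log_add_one_le_harmonic n
  have h2 := harmonic_le_one_add_log n
  have h3 : Real.log n ≤ Real.log ((n + 1 : ℕ) : ℝ) :=
    Real.log_le_log (by exact_mod_cast hn) (by exact_mod_cast Nat.le_succ n)
  rw [abs_le]
  constructor <;> linarith

theorem abs_sum_bernoulliParam_one_sub_log_le {n : ℕ} (hn : 2 ≤ n) :
    |∑ j ∈ Finset.range (n - 1), bernoulliParam 1 j - 1 * Real.log n| ≤ 3 := by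
  obtain ⟨m, rfl⟩ := Nat.exists_eq_add_of_le' hn
  have h := abs_le.1 (abs_harmonic_sub_log_le (n := m + 2) (by omega))
  rw [show m + 2 - 1 = m + 1 by omega, sum_bernoulliParam_one, abs_le]
  constructor <;> linarith [h.1, h.2]

theorem abs_sum_bernoulliParam_two_sub_log_le {n : ℕ} (hn : 1 ≤ n) :
    |∑ j ∈ Finset.range n, bernoulliParam 2 j - 1 / 2 * Real.log n| ≤ 2 := by
  obtain ⟨m, rfl⟩ := Nat.exists_eq_add_of_le' hn
  have h := abs_le.1 (abs_harmonic_sub_log_le (n := m + 1) (by omega))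
  rw [sum_bernoulliParam_two, abs_le]
  constructor <;> linarith [h.1, h.2]

theorem abs_sum_bernoulliParam_two_pred_sub_log_le {n : ℕ} (hn : 1 ≤ n) :
    |∑ j ∈ Finset.range (n - 1), bernoulliParam 2 j - 1 / 2 * Real.log n| ≤ 3 := by
  have h := abs_le.1 (abs_sum_bernoulliParam_two_sub_log_le hn)
  obtain ⟨m, rfl⟩ := Nat.exists_eq_add_of_le' hn
  rw [Finset.sum_range_succ] at h
  have hm := bernoulliParam_mem 2 m
  rw [Nat.add_sub_cancel, abs_le]
  constructor <;> linarith [h.1, h.2, hm.1, hm.2]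

end Parameters

section Limits

variable {k : ℕ} {N d : ℕ → ℕ} {u D : ℝ}

theorem tendsto_mul_log (hu : 0 < u) : Tendsto (fun n : ℕ => u * Real.log n) atTop atTop :=
  (Real.tendsto_log_atTop.comp tendsto_natCast_atTop_atTop).const_mul_atTop hu

theorem tendsto_bernoulliCdf_gaussian (hk : 1 ≤ k) (hu : 0 < u)
    (hD : ∀ᶠ n in atTop, |∑ j ∈ Finset.range (N n), bernoulliParam k j - u * Real.log n| ≤ D)
    {a : ℝ} (hd : (fun n : ℕ => (d n : ℝ) - (u * Real.log n + a * √(u * Real.log n)))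
      =o[atTop] (fun n : ℕ => √(Real.log n))) :
    Tendsto (fun n => bernoulliCdf k (N n) (d n)) atTop (𝓝 (cdf (gaussianReal 0 1) a)) := by
  refine tendsto_bernoulliSum_Iio (bernoulliParam_mem k) (sum_bernoulliParam_sq_le hk)
    (tendsto_mul_log hu) hD ?_
  have h1 := (hd.tendsto_div_nhds_zero.div_const (√u)).add_const a
  rw [zero_div, zero_add] at h1
  refine h1.congr' ?_
  filter_upwards [(tendsto_mul_log hu).eventually_gt_atTop 0] with n hn
  have hlog : 0 < Real.log n := (mul_pos_iff_of_pos_left hu).1 hn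
  rw [Real.sqrt_mul hu.le]
  have h2 : √u ≠ 0 := (Real.sqrt_pos.2 hu).ne'
  have h3 : √(Real.log n) ≠ 0 := (Real.sqrt_pos.2 hlog).ne'
  field_simp
  ring

theorem tendsto_bernoulliSum_threshold (hk : 1 ≤ k) (hu : 0 < u)
    (hD : ∀ᶠ n in atTop, |∑ j ∈ Finset.range (N n), bernoulliParam k j - u * Real.log n| ≤ D)
    (b : ℝ) :
    Tendsto (fun n => (bernoulliSum (bernoulliParam k) (N n)).real
      (Set.Iio (u * Real.log n + b * √(u * Real.log n)))) atTop
      (𝓝 (cdf (gaussianReal 0 1) b)) := by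
  refine tendsto_bernoulliSum_Iio (bernoulliParam_mem k) (sum_bernoulliParam_sq_le hk)
    (tendsto_mul_log hu) hD ?_
  refine tendsto_const_nhds.congr' ?_
  filter_upwards [(tendsto_mul_log hu).eventually_gt_atTop 0] with n hn
  have : √(u * Real.log n) ≠ 0 := (Real.sqrt_pos.2 hn).ne'
  field_simp
  ring

theorem eventually_mul_sqrt_lt (hu : 0 < u) {r : ℝ} (hr : 0 < r) (b : ℝ) :
    ∀ᶠ n : ℕ in atTop, b * √(u * Real.log n) < r * (u * Real.log n) := by
  have h : Tendsto (fun n : ℕ => r * √(u * Real.log n)) atTop atTop :=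
    (Real.tendsto_sqrt_atTop.comp (tendsto_mul_log hu)).const_mul_atTop hr
  filter_upwards [h.eventually_gt_atTop b, (tendsto_mul_log hu).eventually_gt_atTop 0] with n hn h0
  have hs : 0 < √(u * Real.log n) := Real.sqrt_pos.2 h0
  calc b * √(u * Real.log n) < r * √(u * Real.log n) * √(u * Real.log n) :=
        mul_lt_mul_of_pos_right hn hs
    _ = r * (u * Real.log n) := by rw [mul_assoc, Real.mul_self_sqrt h0.le]

theorem tendsto_bernoulliCdf_zero (hk : 1 ≤ k) (hu : 0 < u)
    (hD : ∀ᶠ n in atTop, |∑ j ∈ Finset.range (N n), bernoulliParam k j - u * Real.log n| ≤ D)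
    (hd : limsup (fun n : ℕ => (((d n : ℝ) / (u * Real.log n) : ℝ) : EReal)) atTop < 1) :
    Tendsto (fun n => bernoulliCdf k (N n) (d n)) atTop (𝓝 0) := by
  have := isProbabilityMeasure_bernoulliSum (bernoulliParam_mem k)
  obtain ⟨r, hr1, hr2⟩ := EReal.lt_iff_exists_real_btwn.1 hd
  have hr2 : r < 1 := by exact_mod_cast hr2
  refine tendsto_order.2 ⟨fun c hc => Eventually.of_forall fun n =>
    hc.trans_le measureReal_nonneg, fun c hc => ?_⟩
  -- Choose a Gaussian quantile below level `c`. A dimension at most `r u log n` with `r < 1` is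
  -- eventually under the corresponding threshold, whatever `b` is.
  obtain ⟨b, hb⟩ := ((tendsto_cdf_atBot (gaussianReal 0 1)).eventually (gt_mem_nhds hc)).exists
  filter_upwards [eventually_lt_of_limsup_lt hr1, (tendsto_mul_log hu).eventually_gt_atTop 0,
    eventually_mul_sqrt_lt hu (sub_pos.2 hr2) (-b),
    (tendsto_bernoulliSum_threshold hk hu hD b).eventually (gt_mem_nhds hb)] with n h1 h2 h3 h4
  have h1 : (d n : ℝ) / (u * Real.log n) < r := by exact_mod_cast h1
  rw [div_lt_iff₀ h2] at h1
  refine lt_of_le_of_lt (measureReal_mono (Set.Iio_subset_Iio ?_)) h4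
  linarith

theorem tendsto_bernoulliCdf_one (hk : 1 ≤ k) (hu : 0 < u)
    (hD : ∀ᶠ n in atTop, |∑ j ∈ Finset.range (N n), bernoulliParam k j - u * Real.log n| ≤ D)
    (hd : 1 < liminf (fun n : ℕ => (((d n : ℝ) / (u * Real.log n) : ℝ) : EReal)) atTop) :
    Tendsto (fun n => bernoulliCdf k (N n) (d n)) atTop (𝓝 1) := by
  have := isProbabilityMeasure_bernoulliSum (bernoulliParam_mem k)
  obtain ⟨r, hr1, hr2⟩ := EReal.lt_iff_exists_real_btwn.1 hd
  have hr1 : 1 < r := by exact_mod_cast hr1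
  refine tendsto_order.2 ⟨fun c hc => ?_, fun c hc => Eventually.of_forall fun n =>
    measureReal_le_one.trans_lt hc⟩
  obtain ⟨b, hb⟩ := ((tendsto_cdf_atTop (gaussianReal 0 1)).eventually (lt_mem_nhds hc)).exists
  filter_upwards [eventually_lt_of_lt_liminf hr2, (tendsto_mul_log hu).eventually_gt_atTop 0,
    eventually_mul_sqrt_lt hu (sub_pos.2 hr1) b,
    (tendsto_bernoulliSum_threshold hk hu hD b).eventually (lt_mem_nhds hb)] with n h1 h2 h3 h4
  have h1 : r < (d n : ℝ) / (u * Real.log n) := by exact_mod_cast h1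
  rw [lt_div_iff₀ h2] at h1
  refine h4.trans_le (measureReal_mono (Set.Iio_subset_Iio ?_))
  linarith

end Limits

/-! ### Uniform bounds for the three types, and the limits. -/

/-- The non-absorption probability is squeezed between Bernoulli sum probabilities. -/
theorem exists_bernoulliCdf_bounds (T : ReflType) :
    ∃ (k : ℕ) (N N' : ℕ → ℕ) (D : ℝ), 1 ≤ k ∧
      (∀ᶠ n in atTop, |∑ j ∈ Finset.range (N n), bernoulliParam k j - T.u * Real.log n| ≤ D) ∧
      (∀ᶠ n in atTop, |∑ j ∈ Finset.range (N' n), bernoulliParam k j - T.u * Real.log n| ≤ D) ∧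
      ∀ (n d : ℕ) {Ω : Type*} [MeasurableSpace Ω] (P : Measure Ω) [IsProbabilityMeasure P]
        (ξ : Ω → Fin n → EuclideanSpace ℝ (Fin d)), 2 ≤ n → Admissible T P ξ →
          2 * bernoulliCdf k (N n) d - bernoulliCdf k (N' n) d ≤ nonAbsorption T P ξ ∧
            nonAbsorption T P ξ ≤ bernoulliCdf k (N' n) d := by
  cases T with
  | A =>
    have h : ∀ᶠ n : ℕ in atTop, |∑ j ∈ Finset.range (n - 1), bernoulliParam 1 j -
        ReflType.A.u * Real.log n| ≤ 3 := by
      filter_upwards [eventually_ge_atTop 2] with n hn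
      exact abs_sum_bernoulliParam_one_sub_log_le hn
    refine ⟨1, fun n => n - 1, fun n => n - 1, 3, le_rfl, h, h, ?_⟩
    intro n d Ω _ P _ ξ hn hξ
    obtain ⟨m, rfl⟩ := Nat.exists_eq_add_of_le' hn
    rw [IsTypeA.nonAbsorption_eq (m := m + 1) hξ (Nat.succ_pos m)]
    simp only [show m + 2 - 1 = m + 1 by omega]
    constructor <;> linarith
  | B =>
    have h : ∀ᶠ n : ℕ in atTop, |∑ j ∈ Finset.range n, bernoulliParam 2 j -
        ReflType.B.u * Real.log n| ≤ 2 := by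
      filter_upwards [eventually_ge_atTop 1] with n hn
      exact abs_sum_bernoulliParam_two_sub_log_le hn
    refine ⟨2, id, id, 2, one_le_two, h, h, ?_⟩
    intro n d Ω _ P _ ξ hn hξ
    rw [IsTypeB.nonAbsorption_eq hξ (by omega)]
    constructor <;> simp only [id] <;> linarith
  | D =>
    refine ⟨2, id, fun n => n - 1, 3, one_le_two, ?_, ?_, ?_⟩
    · filter_upwards [eventually_ge_atTop 1] with n hn
      exact (abs_sum_bernoulliParam_two_sub_log_le hn).trans (by norm_num)
    · filter_upwards [eventually_ge_atTop 1] with n hn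
      exact abs_sum_bernoulliParam_two_pred_sub_log_le hn
    · intro n d Ω _ P _ ξ hn hξ
      obtain ⟨m, rfl⟩ := Nat.exists_eq_add_of_le' hn
      exact IsTypeD.nonAbsorption_bounds (m := m + 1) hξ

end ConvHullWalk

theorem theorem5p2 (T : ConvHullWalk.ReflType) (d : ℕ → ℕ)
    {Ω : ℕ → Type*} [∀ n, MeasurableSpace (Ω n)]
    (P : ∀ n, Measure (Ω n)) [∀ n, IsProbabilityMeasure (P n)]
    (ξ : ∀ n, Ω n → Fin n → EuclideanSpace ℝ (Fin (d n)))
    (hξ : ∀ᶠ n in atTop, ConvHullWalk.Admissible T (P n) (ξ n)) :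
    (∀ a : ℝ,
      (fun n : ℕ => (d n : ℝ) - (T.u * Real.log n + a * √(T.u * Real.log n)))
          =o[atTop] (fun n : ℕ => √(Real.log n)) →
      Tendsto (fun n => ConvHullWalk.nonAbsorption T (P n) (ξ n)) atTop
        (𝓝 (1 / √(2 * Real.pi) * ∫ t in Set.Iic a, Real.exp (-t ^ 2 / 2)))) ∧
    (limsup (fun n : ℕ => (((d n : ℝ) / (T.u * Real.log n) : ℝ) : EReal)) atTop < 1 →
      Tendsto (fun n => ConvHullWalk.nonAbsorption T (P n) (ξ n)) atTop (𝓝 0)) ∧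
    (1 < liminf (fun n : ℕ => (((d n : ℝ) / (T.u * Real.log n) : ℝ) : EReal)) atTop →
      Tendsto (fun n => ConvHullWalk.nonAbsorption T (P n) (ξ n)) atTop (𝓝 1)) := by
  obtain ⟨k, N, N', D, hk, hN, hN', hbound⟩ := ConvHullWalk.exists_bernoulliCdf_bounds T
  have hu : 0 < T.u := by cases T <;> norm_num [ConvHullWalk.ReflType.u]
  have hsqueeze : ∀ c : ℝ,
      Tendsto (fun n => ConvHullWalk.bernoulliCdf k (N n) (d n)) atTop (𝓝 c) →
      Tendsto (fun n => ConvHullWalk.bernoulliCdf k (N' n) (d n)) atTop (𝓝 c) →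
      Tendsto (fun n => ConvHullWalk.nonAbsorption T (P n) (ξ n)) atTop (𝓝 c) := by
    intro c h1 h2
    -- The lower bound tends to `2c - c`, so it closes the squeeze: the two Bernoulli sums differ by
    -- at most a bounded number in mean and share their limit.
    have h3 := (h1.const_mul 2).sub h2
    rw [show 2 * c - c = c by ring] at h3
    have hev := hξ.and (eventually_ge_atTop 2)
    refine tendsto_of_tendsto_of_tendsto_of_le_of_le' h3 h2 ?_ ?_
    · filter_upwards [hev] with n hn
      exact (hbound n (d n) (P n) (ξ n) hn.2 hn.1).1
    · filter_upwards [hev] with n hn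
      exact (hbound n (d n) (P n) (ξ n) hn.2 hn.1).2
  refine ⟨fun a ha => ?_, fun h => ?_, fun h => ?_⟩
  · rw [← ConvHullWalk.cdf_gaussianReal_eq]
    exact hsqueeze _ (ConvHullWalk.tendsto_bernoulliCdf_gaussian hk hu hN ha)
      (ConvHullWalk.tendsto_bernoulliCdf_gaussian hk hu hN' ha)
  · exact hsqueeze _ (ConvHullWalk.tendsto_bernoulliCdf_zero hk hu hN h)
      (ConvHullWalk.tendsto_bernoulliCdf_zero hk hu hN' h)
  · exact hsqueeze _ (ConvHullWalk.tendsto_bernoulliCdf_one hk hu hN h)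
      (ConvHullWalk.tendsto_bernoulliCdf_one hk hu hN' h)
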